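/- **Model.** Let $(Y^i,X^i)$, $1\le i\le n$, be i.i.d. copies of $(Y,X)$ with $Y\in\{+1,-1\}$, $\Pr(Y=+1)=\pi_+\in(0,1)$, $\pi_-=1-\pi_+$, $X=(X_1,\dots,X_p)$, following the semiparametric LDA model $$(h_1(X_1),\dots,h_p(X_p))\mid Y=\pm1\ \sim\ N(\mu_\pm,\Sigma),$$ where each $h_j$ is an unknown strictly increasing function on the range of $X_j$, and, for identifiability, $\mu_+=0$ and $\Sigma_{jj}=1$ for all $j$. Write $\mu_{\pm j}$ for the entries of $\mu_\pm$ and $\sigma_{jk}$ for those of $\Sigma$. **Estimators.** Let $n_\pm=\#\{i:Y^i=\pm1\}$, let $\tilde F_{+j}$ be the empirical distribution function of $X_j$ in class $+1$, and let $\hat F_{+j}$ be $\tilde F_{+j}$ Winsorized at $(1/n_+^2,\,1-1/n_+^2)$: it equals $1-1/n_+^2$ where $\tilde F_{+j}>1-1/n_+^2$, $1/n_+^2$ where $\tilde F_{+j}<1/n_+^2$, and $\tilde F_{+j}$ otherwise. Put $\hat h_j=\Phi^{-1}\circ\hat F_{+j}$ with $\Phi$ the standard normal distribution function, $\hat\mu_{\pm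 j}=n_\pm^{-1}\sum_{Y^i=\pm1}\hat h_j(X^i_j)$, and let $$\hat\sigma_{jk}=\frac1{n-2}\sum_{s=\pm1}\ \sum_{Y^i=s}\{\hat h_j(X^i_j)-\hat\mu_{sj}\}\{\hat h_k(X^i_k)-\hat\mu_{sk}\}$$ be the pooled sample covariance. **Bounds.** For $c,C>0$ and $0<\rho<1/3$ define $$\zeta_1^*(\epsilon)=2e^{-cn\epsilon^2}+4e^{-cn^{1-2\rho}\epsilon^2/\rho}+4e^{-cn^{1/2-\rho}},$$ $$\zeta_2^*(\epsilon)=Ce^{-cn\epsilon^2}+Ce^{-cn^{1/3-\rho}}+Ce^{-cn^{1-\rho}}+Ce^{-c(\log^2 n)n^{1-2\rho}\epsilon^2/\rho^2},$$ $$\zeta_1(\epsilon)=\zeta_1^*(\pi_+^{1/2}\epsilon/2)+\zeta_1^*(\pi_-^{1/2}\epsilon/2)+4e^{-cn},$$ $$\zeta_2(\epsilon)=\zeta_2^*(\pi_+^{1/2}\epsilon/2)+\zeta_2^*(\pi_-^{1/2}\epsilon/2)+4e^{-cn}+2\zeta_1(\epsilon).$$ **Claim.** For every $\pi_+\in(0,1)$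 and every $M$ there are constants $c,C>0$, depending only on $\pi_+$ and $M$, such that for every $\rho\in(0,1/3)$ there is $\epsilon_0>0$ such that, for all $n$ and $p$, every model as above with $\max_j|\mu_{-j}|\le M$, all $0<\epsilon<\epsilon_0$ and all $j,k$, $$\Pr\bigl(|(\hat\mu_{+j}-\hat\mu_{-j})-(\mu_{+j}-\mu_{-j})|>\epsilon\bigr)\le\zeta_1(\epsilon),\qquad \Pr\bigl(|\hat\sigma_{jk}-\sigma_{jk}|>\epsilon\bigr)\le\zeta_2(\epsilon).$$ -/

import Mathlib

open MeasureTheory ProbabilityTheory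

noncomputable section

namespace SeLDA

/-- The two-class semiparametric LDA model for the law `D` of a pair `(Y, X)` with label
`Y ∈ {+1, -1}` and predictors `X = (X_1, …, X_p)`:
`(h_1(X_1), …, h_p(X_p)) | Y = ±1 ∼ N(μ_±, S)`, each `h_j` being strictly increasing on a set in
which `X_j` takes its values almost surely, normalized by `μ_+ = 0` and `S_jj = 1`.
Here `πp = Pr(Y = +1)`. -/
structure IsModel {p : ℕ} (D : Measure (ℤ × (Fin p → ℝ))) (πp : ℝ) (h : Fin p → ℝ → ℝ)
    (μp μm : EuclideanSpace ℝ (Fin p)) (S : Matrix (Fin p) (Fin p) ℝ) : Prop where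
  isProbabilityMeasure : IsProbabilityMeasure D
  prob_pos : D.real {z | z.1 = 1} = πp
  prob_neg : D.real {z | z.1 = -1} = 1 - πp
  strictMono : ∀ j, ∃ s : Set ℝ, StrictMonoOn (h j) s ∧ ∀ᵐ z ∂D, z.2 j ∈ s
  posSemidef : S.PosSemidef
  law_pos : HasLaw (fun z : ℤ × (Fin p → ℝ) => WithLp.toLp 2 fun j => h j (z.2 j))
    (multivariateGaussian μp S) (cond D {z | z.1 = 1})
  law_neg : HasLaw (fun z : ℤ × (Fin p → ℝ) => WithLp.toLp 2 fun j => h j (z.2 j))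
    (multivariateGaussian μm S) (cond D {z | z.1 = -1})
  mean_pos : μp = 0
  diag_one : ∀ j, S j j = 1

/-- The standard normal quantile function `Φ⁻¹` (the inverse of `Φ` on `(0, 1)`). -/
def normalQuantile (u : ℝ) : ℝ := sInf {t : ℝ | u ≤ cdf (gaussianReal 0 1) t}

section Estimators

variable {n p : ℕ} (y : Fin n → ℤ) (x : Fin n → Fin p → ℝ)

/-- The size `n_s` of class `s` in the sample `(y, x)`. -/
def classSize (s : ℤ) : ℕ := (Finset.univ.filter fun i => y i = s).card

/-- The empirical distribution function of the `j`-th predictor within class `s`. -/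
def ecdf (s : ℤ) (j : Fin p) (t : ℝ) : ℝ :=
  ((Finset.univ.filter fun i => y i = s ∧ x i j ≤ t).card : ℝ) / (classSize y s : ℝ)

/-- The empirical distribution function of the `j`-th predictor within class `+1`,
Winsorized at `(1 / n_+ ^ 2, 1 - 1 / n_+ ^ 2)`. -/
def winsorizedCdf (j : Fin p) (t : ℝ) : ℝ :=
  if 1 - 1 / (classSize y 1 : ℝ) ^ 2 < ecdf y x 1 j t then 1 - 1 / (classSize y 1 : ℝ) ^ 2
  else if 1 / (classSize y 1 : ℝ) ^ 2 ≤ ecdf y x 1 j t then ecdf y x 1 j t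
  else 1 / (classSize y 1 : ℝ) ^ 2

/-- The estimated transformation `ĥ_j = Φ⁻¹ ∘ F̂_{+j}`. -/
def hHat (j : Fin p) (t : ℝ) : ℝ := normalQuantile (winsorizedCdf y x j t)

/-- The sample mean `μ̂_{sj}` of `ĥ_j(X_j)` within class `s`. -/
def muHat (s : ℤ) (j : Fin p) : ℝ :=
  (∑ i with y i = s, hHat y x j (x i j)) / (classSize y s : ℝ)

/-- The pooled sample covariance `σ̂_{jk}` of `ĥ_j(X_j)` and `ĥ_k(X_k)`. -/
def sigmaHat (j k : Fin p) : ℝ :=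
  ((∑ i with y i = 1,
      (hHat y x j (x i j) - muHat y x 1 j) * (hHat y x k (x i k) - muHat y x 1 k)) +
    ∑ i with y i = -1,
      (hHat y x j (x i j) - muHat y x (-1) j) * (hHat y x k (x i k) - muHat y x (-1) k)) /
    ((n : ℝ) - 2)

end Estimators

/-- The one-class bound `ζ₁*(ε)`. -/
def zetaStar₁ (c : ℝ) (n : ℕ) (ρ ε : ℝ) : ℝ :=
  2 * Real.exp (-c * n * ε ^ 2)
    + 4 * Real.exp (-c * (n : ℝ) ^ (1 - 2 * ρ) * ε ^ 2 / ρ)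
    + 4 * Real.exp (-c * (n : ℝ) ^ (1 / 2 - ρ))

/-- The one-class bound `ζ₂*(ε)`; `C` is the generic constant in front of the exponentials. -/
def zetaStar₂ (c C : ℝ) (n : ℕ) (ρ ε : ℝ) : ℝ :=
  C * Real.exp (-c * n * ε ^ 2)
    + C * Real.exp (-c * (n : ℝ) ^ (1 / 3 - ρ))
    + C * Real.exp (-c * (n : ℝ) ^ (1 - ρ))
    + C * Real.exp (-c * Real.log n ^ 2 * (n : ℝ) ^ (1 - 2 * ρ) * ε ^ 2 / ρ ^ 2)

/-- The two-class bound `ζ₁(ε)` for the mean difference; `πp = π_+` and `1 - πp = π_-`. -/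
def zeta₁ (c πp : ℝ) (n : ℕ) (ρ ε : ℝ) : ℝ :=
  zetaStar₁ c n ρ (πp ^ (1 / 2 : ℝ) * ε / 2)
    + zetaStar₁ c n ρ ((1 - πp) ^ (1 / 2 : ℝ) * ε / 2)
    + 4 * Real.exp (-c * n)

/-- The two-class bound `ζ₂(ε)` for the pooled covariance. -/
def zeta₂ (c C πp : ℝ) (n : ℕ) (ρ ε : ℝ) : ℝ :=
  zetaStar₂ c C n ρ (πp ^ (1 / 2 : ℝ) * ε / 2)
    + zetaStar₂ c C n ρ ((1 - πp) ^ (1 / 2 : ℝ) * ε / 2)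
    + 4 * Real.exp (-c * n) + 2 * zeta₁ c πp n ρ ε

end SeLDA

end

namespace SeLDA

lemma add_gaussian_exponent_le {a M z m : ℝ} (ha0 : 0 < a) (ha : a < 1) (hm : |m| ≤ M) :
    a * (|z| + 1) ^ 2 / 2 - (z - m) ^ 2 / 2
      ≤ ((1 + M) ^ 2 / (1 - a) + 1 / 2) + -((1 - a) / 4) * z ^ 2 := by
  have h1 : 0 < 1 - a := by linarith
  have hz : 0 ≤ |z| := abs_nonneg z
  have hzz : z ^ 2 = |z| ^ 2 := (sq_abs z).symm
  have h2 : z * m ≤ |z| * M :=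
    (le_abs_self _).trans (by rw [abs_mul]; exact mul_le_mul_of_nonneg_left hm hz)
  have h3 : (1 + M) * |z| ≤ (1 + M) ^ 2 / (1 - a) + (1 - a) / 4 * |z| ^ 2 := by
    have : (1 + M) ^ 2 / (1 - a) + (1 - a) / 4 * |z| ^ 2 - (1 + M) * |z|
        = ((1 + M) - (1 - a) / 2 * |z|) ^ 2 / (1 - a) := by field_simp; ring
    have h4 : 0 ≤ ((1 + M) - (1 - a) / 2 * |z|) ^ 2 / (1 - a) := by positivity
    linarith
  nlinarith [sq_nonneg m, mul_nonneg hz h1.le]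

/-- Uniform bound for exponential-square moments of the normal laws with bounded mean. -/
lemma exists_lintegral_exp_sq_gaussianReal_le {a : ℝ} (ha0 : 0 < a) (ha : a < 1) (M : ℝ) :
    ∃ K : ℝ, 1 ≤ K ∧ ∀ m : ℝ, |m| ≤ M →
      ∫⁻ z, ENNReal.ofReal (Real.exp (a * (|z| + 1) ^ 2 / 2)) ∂(gaussianReal m 1)
        ≤ ENNReal.ofReal K := by
  by_cases hM : 0 ≤ M
  swap
  · exact ⟨1, le_rfl, fun m hm => absurd ((abs_nonneg m).trans hm) hM⟩
  set b := (1 - a) / 4 with hb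
  have hb0 : 0 < b := by rw [hb]; linarith
  set C := Real.exp ((1 + M) ^ 2 / (1 - a) + 1 / 2)
  have hint : Integrable (fun z : ℝ => C * Real.exp (-b * z ^ 2)) :=
    (integrable_exp_neg_mul_sq hb0).const_mul C
  refine ⟨max 1 (∫ z : ℝ, C * Real.exp (-b * z ^ 2)), le_max_left _ _, fun m hm => ?_⟩
  rw [gaussianReal_of_var_ne_zero _ one_ne_zero,
    lintegral_withDensity_eq_lintegral_mul _ (measurable_gaussianPDF _ _)
      (by fun_prop)]
  refine le_trans ?_ (ENNReal.ofReal_le_ofReal (le_max_right _ _))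
  rw [ofReal_integral_eq_lintegral_ofReal hint (Filter.Eventually.of_forall fun z => by positivity)]
  refine lintegral_mono fun z => ?_
  simp only [Pi.mul_apply, gaussianPDF]
  rw [← ENNReal.ofReal_mul (gaussianPDFReal_nonneg _ _ _)]
  refine ENNReal.ofReal_le_ofReal ?_
  have h1 : gaussianPDFReal m 1 z ≤ Real.exp (-(z - m) ^ 2 / 2) := by
    rw [gaussianPDFReal]
    simp only [NNReal.coe_one, mul_one]
    refine mul_le_of_le_one_left (by positivity) ?_
    refine inv_le_one_of_one_le₀ ?_
    rw [Real.one_le_sqrt]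
    nlinarith [Real.pi_gt_three]
  refine (mul_le_mul_of_nonneg_right h1 (by positivity)).trans ?_
  rw [← Real.exp_add, ← Real.exp_add]
  refine Real.exp_le_exp.2 ?_
  have := add_gaussian_exponent_le (z := z) ha0 ha hm
  rw [← hb] at this
  linarith

/-- The standard normal distribution function. -/
noncomputable abbrev normalCdf : ℝ → ℝ := cdf (gaussianReal 0 1)

lemma add_le_normalCdf_add {x d η R : ℝ} (hd0 : 0 ≤ d) (hx : |x| ≤ R) (hy : |x + d| ≤ R)
    (h : 3 * η * Real.exp (R ^ 2 / 2) ≤ d) :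
    normalCdf x + η ≤ normalCdf (x + d) := by
  have hR : 0 ≤ R := (abs_nonneg x).trans hx
  have h1 : normalCdf (x + d) - normalCdf x = (gaussianReal 0 1).real (Set.Ioc x (x + d)) := by
    simp only [normalCdf, cdf_eq_real]
    rw [← Set.Iic_sdiff_Iic, measureReal_sdiff (Set.Iic_subset_Iic.2 (by linarith)) measurableSet_Iic]
  suffices η ≤ (gaussianReal 0 1).real (Set.Ioc x (x + d)) by linarith
  rw [measureReal_def, gaussianReal_apply _ one_ne_zero]
  have h2 : ENNReal.ofReal η ≤ ∫⁻ z in Set.Ioc x (x + d), gaussianPDF 0 1 z := by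
    calc ENNReal.ofReal η
        ≤ ENNReal.ofReal (3⁻¹ * Real.exp (-R ^ 2 / 2)) * volume (Set.Ioc x (x + d)) := by
          rw [Real.volume_Ioc, ← ENNReal.ofReal_mul (by positivity)]
          refine ENNReal.ofReal_le_ofReal ?_
          have : Real.exp (-R ^ 2 / 2) * Real.exp (R ^ 2 / 2) = 1 := by
            rw [← Real.exp_add]; simp; ring
          have h3 := mul_le_mul_of_nonneg_left h (Real.exp_pos (-R ^ 2 / 2)).le
          have h4 : Real.exp (-R ^ 2 / 2) * (3 * η * Real.exp (R ^ 2 / 2)) = 3 * η := by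
            linear_combination 3 * η * this
          rw [add_sub_cancel_left]
          linarith
      _ = ∫⁻ z in Set.Ioc x (x + d), ENNReal.ofReal (3⁻¹ * Real.exp (-R ^ 2 / 2)) := by
          rw [setLIntegral_const]
      _ ≤ _ := by
          refine setLIntegral_mono (measurable_gaussianPDF _ _) fun z hz => ?_
          refine ENNReal.ofReal_le_ofReal ?_
          rw [gaussianPDFReal]
          simp only [NNReal.coe_one, mul_one, sub_zero]
          have hzR : |z| ≤ R := abs_le.2 ⟨by linarith [neg_le_of_abs_le hx, hz.1],
            by linarith [le_of_abs_le hy, hz.2]⟩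
          have hz2 : z ^ 2 ≤ R ^ 2 := sq_le_sq' (neg_le_of_abs_le hzR) (le_of_abs_le hzR)
          refine mul_le_mul ?_ (Real.exp_le_exp.2 (by linarith)) (by positivity) (by positivity)
          refine inv_anti₀ (by positivity) ?_
          rw [Real.sqrt_le_left (by norm_num)]
          nlinarith [Real.pi_lt_four]
  refine (ENNReal.ofReal_le_iff_le_toReal ?_).1 h2
  rw [← gaussianReal_apply _ one_ne_zero]
  exact measure_ne_top _ _

lemma continuous_normalCdf : Continuous normalCdf := by
  have h : NullSingletonClass (gaussianReal 0 1) := nullSingletonClass_gaussianReal one_ne_zero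
  refine continuous_iff_continuousAt.2 fun x => ?_
  have := (cdf (gaussianReal 0 1)).measure_singleton x
  rw [measure_cdf, measure_singleton] at this
  have h1 : cdf (gaussianReal 0 1) x ≤ Function.leftLim (cdf (gaussianReal 0 1)) x := by
    have := ENNReal.ofReal_eq_zero.1 this.symm
    linarith
  have h2 := (cdf (gaussianReal 0 1)).mono.leftLim_le (le_refl x)
  rw [(cdf (gaussianReal 0 1)).mono.continuousAt_iff_leftLim_eq_rightLim,
    StieltjesFunction.rightLim_eq]
  exact le_antisymm h2 h1

lemma exists_normalCdf_eq {u : ℝ} (h0 : 0 < u) (h1 : u < 1) : ∃ q, normalCdf q = u := by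
  obtain ⟨x, hx⟩ := ((tendsto_cdf_atBot (gaussianReal 0 1)).eventually_lt_const h0).exists
  obtain ⟨y, hy⟩ := ((tendsto_cdf_atTop (gaussianReal 0 1)).eventually_const_lt h1).exists
  exact mem_range_of_exists_le_of_exists_ge continuous_normalCdf ⟨x, hx.le⟩ ⟨y, hy.le⟩

lemma lt_of_normalCdf_lt {x y : ℝ} (h : normalCdf x < normalCdf y) : x < y :=
  lt_of_not_ge fun hyx => (h.trans_le (monotone_cdf _ hyx)).false

lemma normalQuantile_mem_Icc {u x y : ℝ} (hx : normalCdf x < u) (hy : u ≤ normalCdf y) :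
    normalQuantile u ∈ Set.Icc x y := by
  have hb : ∀ t ∈ {t : ℝ | u ≤ cdf (gaussianReal 0 1) t}, x ≤ t := fun t ht =>
    (lt_of_normalCdf_lt (hx.trans_le ht)).le
  exact ⟨le_csInf ⟨y, hy⟩ hb, csInf_le ⟨x, hb⟩ hy⟩

/-- Linearization of the normal quantile function. -/
lemma abs_normalQuantile_sub_le {u z η : ℝ} (hη : 0 < η) (hu : |u - normalCdf z| < η)
    (hd : 3 * η * Real.exp ((|z| + 1) ^ 2 / 2) ≤ 1) :
    |normalQuantile u - z| ≤ 3 * η * Real.exp ((|z| + 1) ^ 2 / 2) := by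
  set d := 3 * η * Real.exp ((|z| + 1) ^ 2 / 2) with hdd
  have hd0 : 0 < d := by positivity
  have hzd : |z - d| ≤ |z| + 1 := (abs_sub _ _).trans (by rw [abs_of_pos hd0]; linarith)
  have hzd' : |z + d| ≤ |z| + 1 := (abs_add_le _ _).trans (by rw [abs_of_pos hd0]; linarith)
  have hz : |z| ≤ |z| + 1 := by linarith
  have h1 := add_le_normalCdf_add hd0.le hz hzd' hdd.ge
  have h2 := add_le_normalCdf_add (x := z - d) hd0.le hzd (by simp) hdd.ge
  rw [sub_add_cancel] at h2
  obtain ⟨h3, h4⟩ := abs_lt.1 hu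
  obtain ⟨h5, h6⟩ := normalQuantile_mem_Icc (u := u) (x := z - d) (y := z + d)
    (by linarith) (by linarith)
  exact abs_le.2 ⟨by linarith, by linarith⟩

lemma exists_gaussian_tail_le : ∃ K : ℝ, 1 ≤ K ∧ ∀ L : ℝ, 0 ≤ L →
    normalCdf (-L) ≤ K * Real.exp (-(L ^ 2 / 4)) ∧
      1 - K * Real.exp (-(L ^ 2 / 4)) ≤ normalCdf L := by
  obtain ⟨K, hK1, hK⟩ := exists_lintegral_exp_sq_gaussianReal_le (a := 1 / 2) (by norm_num)
    (by norm_num) 0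
  have h0 := hK 0 (by simp)
  have key : ∀ L : ℝ, 0 ≤ L → (gaussianReal 0 1).real {z | L ≤ |z|}
      ≤ K * Real.exp (-(L ^ 2 / 4)) := by
    intro L hL
    have h1 := mul_meas_ge_le_lintegral (μ := gaussianReal 0 1)
      (f := fun z => ENNReal.ofReal (Real.exp (1 / 2 * (|z| + 1) ^ 2 / 2))) (by fun_prop)
      (ENNReal.ofReal (Real.exp (L ^ 2 / 4)))
    have h2 : {z | L ≤ |z|} ⊆ {z : ℝ | ENNReal.ofReal (Real.exp (L ^ 2 / 4)) ≤
        ENNReal.ofReal (Real.exp (1 / 2 * (|z| + 1) ^ 2 / 2))} := by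
      intro z hz
      simp only [Set.mem_ofPred_eq] at hz ⊢
      refine ENNReal.ofReal_le_ofReal (Real.exp_le_exp.2 ?_)
      nlinarith
    have h3 : ENNReal.ofReal (Real.exp (L ^ 2 / 4)) * gaussianReal 0 1 {z | L ≤ |z|}
        ≤ ENNReal.ofReal K :=
      (mul_le_mul_right (measure_mono h2) _).trans (h1.trans h0)
    have h4 := ENNReal.toReal_mono ENNReal.ofReal_ne_top h3
    rw [ENNReal.toReal_mul, ENNReal.toReal_ofReal (Real.exp_pos _).le,
      ENNReal.toReal_ofReal (by linarith), ← measureReal_def] at h4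
    rw [Real.exp_neg, ← div_eq_mul_inv, le_div_iff₀' (Real.exp_pos _)]
    exact h4
  refine ⟨K, hK1, fun L hL => ⟨?_, ?_⟩⟩
  · refine le_trans ?_ (key L hL)
    rw [normalCdf, cdf_eq_real]
    refine measureReal_mono fun z hz => ?_
    simp only [Set.mem_Iic, Set.mem_ofPred_eq] at hz ⊢
    exact le_abs.2 (Or.inr (by linarith))
  · have h1 : 1 - normalCdf L = (gaussianReal 0 1).real (Set.Iic L)ᶜ := by
      rw [normalCdf, cdf_eq_real, probReal_compl_eq_one_sub measurableSet_Iic]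
    have h2 : (gaussianReal 0 1).real (Set.Iic L)ᶜ ≤ (gaussianReal 0 1).real {z | L ≤ |z|} := by
      refine measureReal_mono fun z hz => ?_
      simp only [Set.mem_compl_iff, Set.mem_Iic, not_le, Set.mem_ofPred_eq] at hz ⊢
      exact le_abs.2 (Or.inl hz.le)
    linarith [key L hL]

end SeLDA

namespace SeLDA

section Chernoff

variable {Ω α : Type*} [MeasurableSpace Ω] [MeasurableSpace α] {P : Measure Ω}
  [IsProbabilityMeasure P] {D : Measure α} {n : ℕ} {ξ : Fin n → Ω → α}

/-- Chernoff bound for a sum of i.i.d. variables. -/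
lemma measureReal_sum_ge_le_exp (hξ : ∀ i, HasLaw (ξ i) D P) (hind : iIndepFun ξ P)
    {f : α → ℝ} (hf : AEMeasurable f D) {m : ℝ}
    (hm : ∫⁻ z, ENNReal.ofReal (Real.exp (f z)) ∂D ≤ ENNReal.ofReal (Real.exp m)) (x : ℝ) :
    P.real {ω | x ≤ ∑ i, f (ξ i ω)} ≤ Real.exp (n * m - x) := by
  have hfm : ∀ i, AEMeasurable (fun ω => f (ξ i ω)) P := fun i =>
    AEMeasurable.comp_aemeasurable (by rw [(hξ i).map_eq]; exact hf) (hξ i).aemeasurable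
  have hind' : iIndepFun (fun i ω => f (ξ i ω)) P :=
    hind.comp₀ (fun _ => f) (fun i => (hξ i).aemeasurable)
      (fun i => by rw [(hξ i).map_eq]; exact hf)
  have hl : ∀ i, ∫⁻ ω, ENNReal.ofReal (Real.exp (f (ξ i ω))) ∂P ≤ ENNReal.ofReal (Real.exp m) :=
    fun i => by
      rw [← (hξ i).lintegral_comp (f := fun z => ENNReal.ofReal (Real.exp (f z)))] at hm
      · exact hm
      · fun_prop
  have hint : ∀ i ∈ Finset.univ, Integrable (fun ω => Real.exp (1 * f (ξ i ω))) P := by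
    intro i _
    simp only [one_mul]
    refine ⟨(hfm i).exp.aestronglyMeasurable, ?_⟩
    rw [hasFiniteIntegral_iff_ofReal (Filter.Eventually.of_forall fun ω => by positivity)]
    exact (hl i).trans_lt ENNReal.ofReal_lt_top
  have hmgf : ∀ i, mgf (fun ω => f (ξ i ω)) P 1 ≤ Real.exp m := by
    intro i
    rw [mgf, integral_eq_lintegral_of_nonneg_ae
      (Filter.Eventually.of_forall fun ω => by positivity)
      (hint i (Finset.mem_univ i)).aestronglyMeasurable]
    simp only [one_mul]
    exact ENNReal.toReal_le_of_le_ofReal (Real.exp_pos _).le (hl i)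
  have hsum : Integrable (fun ω => Real.exp (1 * (∑ i, fun ω => f (ξ i ω)) ω)) P := by
    refine not_imp_comm.1 integral_undef ?_
    change mgf (∑ i, fun ω => f (ξ i ω)) P 1 ≠ 0
    rw [hind'.mgf_sum₀ hfm]
    exact (Finset.prod_pos fun i hi => mgf_pos (hint i hi)).ne'
  have h1 := measure_ge_le_exp_mul_mgf (μ := P) (X := ∑ i, fun ω => f (ξ i ω)) x zero_le_one hsum
  rw [hind'.mgf_sum₀ hfm] at h1
  simp only [Finset.sum_apply] at h1
  refine h1.trans ?_
  calc Real.exp (-1 * x) * ∏ i, mgf (fun ω => f (ξ i ω)) P 1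
      ≤ Real.exp (-1 * x) * ∏ _i : Fin n, Real.exp m := by
        gcongr with i _
        · exact fun i _ => mgf_nonneg
        · exact hmgf i
    _ = _ := by
        rw [Finset.prod_const, Finset.card_univ, Fintype.card_fin, ← Real.exp_nat_mul,
          ← Real.exp_add]
        congr 1; ring

lemma exp_mul_le_of_abs_le {l x : ℝ} (hl : |l| ≤ 1 / 2) :
    Real.exp (l * x) ≤ 1 + l * x + 8 * l ^ 2 * Real.exp |x| := by
  have h1 : Real.exp (l * x) ≤ 1 + l * x + (l * x) ^ 2 * Real.exp |l * x| := by
    have h := Complex.norm_exp_sub_sum_le_norm_mul_exp ((l * x : ℝ) : ℂ) 2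
    have h' : Complex.exp ((l * x : ℝ) : ℂ)
        - ∑ m ∈ Finset.range 2, ((l * x : ℝ) : ℂ) ^ m / (m.factorial : ℂ)
        = ((Real.exp (l * x) - (1 + l * x) : ℝ) : ℂ) := by
      simp [Finset.sum_range_succ]
    rw [h', Complex.norm_real, Complex.norm_real, Real.norm_eq_abs, Real.norm_eq_abs, sq_abs] at h
    linarith [le_of_abs_le h]
  have h2 : |l * x| ≤ |x| / 2 := by
    rw [abs_mul]; nlinarith [abs_nonneg x]
  have h3 : x ^ 2 ≤ 8 * Real.exp (|x| / 2) := by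
    have := Real.quadratic_le_exp_of_nonneg (x := |x| / 2) (by positivity)
    nlinarith [sq_abs x, abs_nonneg x]
  have h4 : Real.exp (|x| / 2) * Real.exp (|x| / 2) = Real.exp |x| := by
    rw [← Real.exp_add]; ring_nf
  calc Real.exp (l * x) ≤ 1 + l * x + (l * x) ^ 2 * Real.exp |l * x| := h1
    _ ≤ 1 + l * x + l ^ 2 * (8 * Real.exp (|x| / 2)) * Real.exp (|x| / 2) := by
        rw [mul_pow]; gcongr
    _ = _ := by rw [← h4]; ring

lemma measureReal_sum_gt_le_exp [IsProbabilityMeasure D] (hξ : ∀ i, HasLaw (ξ i) D P)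
    (hind : iIndepFun ξ P)
    {f : α → ℝ} (hf : AEMeasurable f D) (h0 : ∫ z, f z ∂D = 0) {K : ℝ}
    (hK : ∫⁻ z, ENNReal.ofReal (Real.exp |f z|) ∂D ≤ ENNReal.ofReal K) {x : ℝ} (hx0 : 0 < x)
    (hx1 : x ≤ 1) :
    P.real {ω | n * x < |∑ i, f (ξ i ω)|} ≤ 2 * Real.exp (-(n * x ^ 2 / (32 * K))) := by
  have hexp : Integrable (fun z => Real.exp |f z|) D := by
    refine ⟨hf.norm.exp.aestronglyMeasurable, ?_⟩
    rw [hasFiniteIntegral_iff_ofReal (Filter.Eventually.of_forall fun ω => by positivity)]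
    exact hK.trans_lt ENNReal.ofReal_lt_top
  have hint : Integrable f D := by
    refine hexp.mono' hf.aestronglyMeasurable (Filter.Eventually.of_forall fun z => ?_)
    rw [Real.norm_eq_abs]
    linarith [Real.add_one_le_exp |f z|]
  have hK1 : 1 ≤ K := by
    have h1 : (1 : ENNReal) ≤ ENNReal.ofReal K := by
      calc (1 : ENNReal) = ∫⁻ _z, 1 ∂D := by simp
        _ ≤ ∫⁻ z, ENNReal.ofReal (Real.exp |f z|) ∂D := lintegral_mono fun z => by
            rw [← ENNReal.ofReal_one]
            exact ENNReal.ofReal_le_ofReal (Real.one_le_exp (abs_nonneg _))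
        _ ≤ _ := hK
    rwa [ENNReal.one_le_ofReal] at h1
  have hmgf : ∀ l : ℝ, |l| ≤ 1 / 2 → ∫⁻ z, ENNReal.ofReal (Real.exp (l * f z)) ∂D
      ≤ ENNReal.ofReal (Real.exp (8 * l ^ 2 * K)) := by
    intro l hl
    have hi : Integrable (fun z => 1 + l * f z + 8 * l ^ 2 * Real.exp |f z|) D :=
      ((integrable_const 1).add (hint.const_mul l)).add (hexp.const_mul _)
    calc ∫⁻ z, ENNReal.ofReal (Real.exp (l * f z)) ∂D
        ≤ ∫⁻ z, ENNReal.ofReal (1 + l * f z + 8 * l ^ 2 * Real.exp |f z|) ∂D :=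
          lintegral_mono fun z => ENNReal.ofReal_le_ofReal (exp_mul_le_of_abs_le hl)
      _ = ENNReal.ofReal (∫ z, (1 + l * f z + 8 * l ^ 2 * Real.exp |f z|) ∂D) :=
          (ofReal_integral_eq_lintegral_ofReal hi (Filter.Eventually.of_forall fun z =>
            (Real.exp_pos _).le.trans (exp_mul_le_of_abs_le hl))).symm
      _ ≤ _ := by
          refine ENNReal.ofReal_le_ofReal ?_
          have hi' : Integrable (fun z => 1 + l * f z) D :=
            (integrable_const 1).add (hint.const_mul l)
          rw [integral_add hi' (hexp.const_mul _),
            integral_add (integrable_const 1) (hint.const_mul l), integral_const_mul,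
            integral_const_mul, h0]
          have : ∫ z, Real.exp |f z| ∂D ≤ K := by
            rw [integral_eq_lintegral_of_nonneg_ae
              (Filter.Eventually.of_forall fun ω => by positivity) hexp.aestronglyMeasurable]
            exact ENNReal.toReal_le_of_le_ofReal (by linarith) hK
          have h2 : 8 * l ^ 2 * ∫ z, Real.exp |f z| ∂D ≤ 8 * l ^ 2 * K := by gcongr
          simp only [integral_const, probReal_univ, smul_eq_mul, mul_one, mul_zero, add_zero]
          linarith [Real.add_one_le_exp (8 * l ^ 2 * K)]
  set l := x / (16 * K) with hl
  have hl0 : 0 < l := by positivity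
  have hl1 : l ≤ 1 / 2 := by
    rw [hl, div_le_iff₀ (by positivity)]; linarith
  have hval : n * (8 * l ^ 2 * K) - l * (n * x) = -(n * x ^ 2 / (32 * K)) := by
    rw [hl]; field_simp; ring
  have e1 := measureReal_sum_ge_le_exp hξ hind (hf.const_mul l)
    (hmgf l (by rwa [abs_of_pos hl0])) (l * (n * x))
  have e2 := measureReal_sum_ge_le_exp hξ hind (hf.const_mul (-l))
    (hmgf (-l) (by rwa [abs_neg, abs_of_pos hl0])) (l * (n * x))
  rw [neg_sq] at e2
  rw [hval] at e1 e2
  refine (measureReal_mono (s₂ := {ω | l * (n * x) ≤ ∑ i, l * f (ξ i ω)} ∪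
    {ω | l * (n * x) ≤ ∑ i, -l * f (ξ i ω)}) ?_ (by finiteness)).trans ((measureReal_union_le _ _).trans
      (by linarith))
  intro ω hω
  simp only [Set.mem_ofPred_eq, Set.mem_union, ← Finset.mul_sum] at hω ⊢
  rcases lt_abs.1 hω with h | h
  · left; gcongr
  · right
    rw [neg_mul, ← mul_neg]; gcongr

end Chernoff

end SeLDA

namespace SeLDA

/-- A monotone function that is close to a multiple of the normal distribution function on a grid
of quantiles is close to it everywhere. -/
lemma abs_sub_mul_normalCdf_le {n : ℕ} (hn : 0 < n) {A : ℝ → ℝ} (hA : Monotone A) {N π τ : ℝ}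
    (hA0 : ∀ t, 0 ≤ A t) (hAN : ∀ t, A t ≤ N) (hπ0 : 0 ≤ π) (hπ1 : π ≤ 1) (hN : |N - π| ≤ τ)
    {q : ℕ → ℝ} (hq : ∀ k, 0 < k → k < n → normalCdf (q k) = k / n)
    (hAq : ∀ k, 0 < k → k < n → |A (q k) - π * (k / n)| ≤ τ) (t : ℝ) :
    |A t - π * normalCdf t| ≤ τ + 2 / n := by
  have hn' : (0 : ℝ) < n := by exact_mod_cast hn
  have hτ : 0 ≤ τ := (abs_nonneg _).trans hN
  set u := normalCdf t with hu
  have hu0 : 0 ≤ u := cdf_nonneg _ _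
  have hu1 : u ≤ 1 := cdf_le_one _ _
  set k := ⌊n * u⌋₊ with hk
  have hk1 : (k : ℝ) ≤ n * u := Nat.floor_le (by positivity)
  have hk2 : n * u < k + 1 := Nat.lt_floor_add_one _
  have hn1 : (0 : ℝ) < 1 / n := by positivity
  have h21 : (2 : ℝ) / n = 2 * (1 / n) := by ring
  have hku : (k : ℝ) / n ≤ u := by rw [div_le_iff₀ hn']; linarith
  have huk : u < k / n + 1 / n := by rw [← add_div, lt_div_iff₀ hn']; linarith
  rw [abs_le]
  constructor
  · by_cases hk' : 2 ≤ k
    · have h1 : 0 < k - 1 := by omega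
      have hkn : k ≤ n := by
        have : (k : ℝ) ≤ n := hk1.trans (by nlinarith)
        exact_mod_cast this
      have h2 : k - 1 < n := by omega
      have hc : ((k - 1 : ℕ) : ℝ) = k - 1 := by rw [Nat.cast_sub (by omega)]; simp
      have h3 := hAq _ h1 h2
      have h4 := hq _ h1 h2
      rw [hc, sub_div] at h3 h4
      have h5 : q (k - 1) < t := lt_of_normalCdf_lt (by rw [h4, ← hu]; linarith)
      have h6 := hA h5.le
      have h7 := (abs_le.1 h3).1
      nlinarith
    · have : (k : ℝ) ≤ 1 := by exact_mod_cast (by omega : k ≤ 1)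
      have h3 : (k : ℝ) / n ≤ 1 / n := by gcongr
      have := hA0 t
      nlinarith
  · by_cases hk' : k + 1 < n
    · have h3 := hAq _ (Nat.succ_pos k) hk'
      have h4 := hq _ (Nat.succ_pos k) hk'
      simp only [Nat.succ_eq_add_one, Nat.cast_add, Nat.cast_one, add_div] at h3 h4
      have h5 : t < q (k + 1) := lt_of_normalCdf_lt (by rw [h4, ← hu]; exact huk)
      have h6 := hA h5.le
      have h7 := (abs_le.1 h3).2
      nlinarith
    · have : (n : ℝ) ≤ k + 1 := by exact_mod_cast (by omega : n ≤ k + 1)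
      have h3 : (n : ℝ) / n ≤ (k + 1) / n := by gcongr
      rw [div_self hn'.ne', add_div] at h3
      have := hAN t
      have := (abs_le.1 hN).2
      nlinarith

section Sample

variable {n p : ℕ} {y : Fin n → ℤ} {x : Fin n → Fin p → ℝ} {j : Fin p}

lemma classSize_eq_sum (y : Fin n → ℤ) (s : ℤ) :
    (classSize y s : ℝ) = ∑ i, if y i = s then (1 : ℝ) else 0 := by
  simp [classSize]

lemma ecdf_nonneg (s : ℤ) (t : ℝ) : 0 ≤ ecdf y x s j t := by unfold ecdf; positivity

lemma ecdf_le_one (s : ℤ) (t : ℝ) : ecdf y x s j t ≤ 1 := by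
  unfold ecdf classSize
  refine div_le_one_of_le₀ ?_ (by positivity)
  exact_mod_cast Finset.card_le_card fun i => by simp +contextual

lemma abs_ecdf_sub_normalCdf_le {z : Fin n → ℝ} (hz : ∀ i l, x l j ≤ x i j ↔ z l ≤ z i)
    {π τ : ℝ} (hn : 0 < n) (hπ0 : 0 < π) (hπ1 : π ≤ 1) (hτ : τ ≤ π / 2)
    (hN : |(classSize y 1 : ℝ) / n - π| ≤ τ)
    {q : ℕ → ℝ} (hq : ∀ k, 0 < k → k < n → normalCdf (q k) = k / n)
    (hAq : ∀ k, 0 < k → k < n →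
      |(∑ i, if y i = 1 ∧ z i ≤ q k then (1 : ℝ) else 0) / n - π * (k / n)| ≤ τ) (i : Fin n) :
    |ecdf y x 1 j (x i j) - normalCdf (z i)| ≤ (4 * τ + 4 / n) / π := by
  have hn' : (0 : ℝ) < n := by exact_mod_cast hn
  set A : ℝ → ℝ := fun t => (∑ i, if y i = 1 ∧ z i ≤ t then (1 : ℝ) else 0) / n with hA
  set N := (classSize y 1 : ℝ) / n with hNdef
  have h1 : |A (z i) - π * normalCdf (z i)| ≤ τ + 2 / n := by
    refine abs_sub_mul_normalCdf_le (N := N) hn ?_ (fun t => ?_) (fun t => ?_) hπ0.le hπ1 hN hq hAq _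
    · intro s t hst
      simp only [hA]
      gcongr with l _
      split_ifs with h1 h2 <;> first | exact absurd ⟨h1.1, h1.2.trans hst⟩ h2 | norm_num
    · simp only [hA]
      refine div_nonneg (Finset.sum_nonneg fun l _ => ?_) hn'.le
      split_ifs <;> norm_num
    · simp only [hA, hNdef, classSize_eq_sum]
      gcongr with l _
      split_ifs with h1 h2 <;> first | exact absurd h1.1 h2 | norm_num
  have hNpos : π / 2 ≤ N := by linarith [(abs_le.1 hN).1]
  have hN0 : 0 < N := by linarith
  have h2 : ecdf y x 1 j (x i j) = A (z i) / N := by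
    simp only [ecdf, hA, hNdef]
    rw [div_div_div_cancel_right₀ hn'.ne']
    congr 1
    rw [Finset.card_filter]
    push_cast
    exact Finset.sum_congr rfl fun l _ => by simp only [hz]
  have hu0 : 0 ≤ normalCdf (z i) := cdf_nonneg _ _
  have hu1 : normalCdf (z i) ≤ 1 := cdf_le_one _ _
  have h3 : |A (z i) - N * normalCdf (z i)| ≤ 2 * τ + 2 / n := by
    have : A (z i) - N * normalCdf (z i)
      = (A (z i) - π * normalCdf (z i)) - (N - π) * normalCdf (z i) := by ring
    rw [this]
    refine (abs_sub _ _).trans ?_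
    rw [abs_mul, abs_of_nonneg hu0]
    have := mul_le_mul hN hu1 hu0 ((abs_nonneg _).trans hN)
    linarith
  have h4 : ecdf y x 1 j (x i j) - normalCdf (z i) = (A (z i) - N * normalCdf (z i)) / N := by
    rw [h2]; field_simp
  rw [h4, abs_div, abs_of_pos hN0]
  calc |A (z i) - N * normalCdf (z i)| / N ≤ (2 * τ + 2 / n) / (π / 2) :=
        div_le_div₀ ((abs_nonneg _).trans h3) h3 (by linarith) hNpos
    _ = _ := by field_simp; ring

lemma abs_winsorizedCdf_sub_ecdf_le (t : ℝ) :
    |winsorizedCdf y x j t - ecdf y x 1 j t| ≤ 1 / (classSize y 1 : ℝ) ^ 2 := by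
  have h0 := ecdf_nonneg (y := y) (x := x) (j := j) 1 t
  have h1 := ecdf_le_one (y := y) (x := x) (j := j) 1 t
  have h2 : (0 : ℝ) ≤ 1 / (classSize y 1 : ℝ) ^ 2 := by positivity
  unfold winsorizedCdf
  split_ifs <;> rw [abs_le] <;> constructor <;> linarith

lemma winsorizedCdf_mem_Icc (h : 2 ≤ classSize y 1) (t : ℝ) :
    winsorizedCdf y x j t ∈
      Set.Icc (1 / (classSize y 1 : ℝ) ^ 2) (1 - 1 / (classSize y 1 : ℝ) ^ 2) := by
  have h' : (2 : ℝ) ≤ classSize y 1 := by exact_mod_cast h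
  have h2 : 1 / (classSize y 1 : ℝ) ^ 2 ≤ 1 / 2 ^ 2 := by gcongr
  unfold winsorizedCdf
  split_ifs <;> constructor <;> linarith

lemma classSize_le (s : ℤ) : classSize y s ≤ n := by
  simpa [classSize] using Finset.card_le_univ (Finset.univ.filter fun i => y i = s)

/-- The linearization weight of the estimated transformation. -/
noncomputable def tailWeight (η z : ℝ) : ℝ := min 1 (3 * η * Real.exp ((|z| + 1) ^ 2 / 2))

lemma tailWeight_nonneg {η : ℝ} (hη : 0 ≤ η) (z : ℝ) : 0 ≤ tailWeight η z :=
  le_min zero_le_one (by positivity)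

lemma tailWeight_le_one (η z : ℝ) : tailWeight η z ≤ 1 := min_le_left _ _

lemma abs_hHat_sub_le (h2 : 2 ≤ classSize y 1) {b η z t : ℝ} (hη : 0 < η)
    (hF : |ecdf y x 1 j t - normalCdf z| + 1 / (classSize y 1 : ℝ) ^ 2 < η) (hb : 1 ≤ b)
    (hb0 : normalCdf (-b) < 1 / (n : ℝ) ^ 2) (hb1 : 1 - 1 / (n : ℝ) ^ 2 ≤ normalCdf b) :
    |hHat y x j t - z| ≤ (b + |z|) * tailWeight η z := by
  have hu : |winsorizedCdf y x j t - normalCdf z| < η := by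
    refine lt_of_le_of_lt (abs_sub_le _ (ecdf y x 1 j t) _) ?_
    linarith [abs_winsorizedCdf_sub_ecdf_le (y := y) (x := x) (j := j) t]
  have hbz : 1 ≤ b + |z| := by linarith [abs_nonneg z]
  unfold hHat tailWeight
  by_cases hd : 3 * η * Real.exp ((|z| + 1) ^ 2 / 2) ≤ 1
  · rw [min_eq_right hd]
    exact (abs_normalQuantile_sub_le hη hu hd).trans (le_mul_of_one_le_left (by positivity) hbz)
  · rw [min_eq_left (not_le.1 hd).le, mul_one]
    refine (abs_sub _ _).trans (add_le_add_left ?_ _)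
    have h2' : (2 : ℝ) ≤ classSize y 1 := by exact_mod_cast h2
    have hle : (classSize y 1 : ℝ) ≤ n := by exact_mod_cast classSize_le 1
    have hle2 : 1 / (n : ℝ) ^ 2 ≤ 1 / (classSize y 1 : ℝ) ^ 2 := by gcongr
    obtain ⟨h3, h4⟩ := winsorizedCdf_mem_Icc (x := x) (j := j) h2 t
    exact abs_le.2 (normalQuantile_mem_Icc (by linarith) (by linarith))

lemma sum_filter_sub_mean_mul_sub_mean {ι : Type*} (F : Finset ι) (hF : F.card ≠ 0)
    (u v : ι → ℝ) (m m' : ℝ) :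
    ∑ i ∈ F, (u i - (∑ l ∈ F, u l) / F.card) * (v i - (∑ l ∈ F, v l) / F.card)
      = ∑ i ∈ F, (u i - m) * (v i - m')
        - F.card * (((∑ l ∈ F, u l) / F.card - m) * ((∑ l ∈ F, v l) / F.card - m')) := by
  have hF' : (F.card : ℝ) ≠ 0 := by exact_mod_cast hF
  have e : ∀ a a' : ℝ, ∑ i ∈ F, (u i - a) * (v i - a') = ∑ i ∈ F, u i * v i
      - a' * ∑ i ∈ F, u i - a * ∑ i ∈ F, v i + F.card * (a * a') := by
    intro a a'
    rw [Finset.mul_sum, Finset.mul_sum, ← Finset.sum_sub_distrib, ← Finset.sum_sub_distrib,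
      ← nsmul_eq_mul, ← Finset.sum_const, ← Finset.sum_add_distrib]
    exact Finset.sum_congr rfl fun i _ => by ring
  rw [e, e]
  field_simp
  ring

/-- The centre of class `s`. -/
noncomputable def classMean (mp mm : Fin p → ℝ) (s : ℤ) (j : Fin p) : ℝ :=
  if s = 1 then mp j else mm j

lemma abs_muHat_sub_le {s : ℤ} {z e : Fin n → ℝ} {m δ : ℝ}
    (hn : 0 < n) {π : ℝ} (hπ : 0 < π) (hN : π / 2 ≤ (classSize y s : ℝ) / n)
    (hz : |∑ i, if y i = s then z i - m else 0| ≤ n * δ)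
    (he : ∀ i, |hHat y x j (x i j) - z i| ≤ e i) (hes : ∑ i, e i ≤ n * δ) :
    |muHat y x s j - m| ≤ 4 * δ / π := by
  have hn' : (0 : ℝ) < n := by exact_mod_cast hn
  have hN' : n * π / 2 ≤ classSize y s := by
    rw [le_div_iff₀ hn'] at hN; linarith
  have hN0 : (0 : ℝ) < classSize y s := by nlinarith [mul_pos hn' hπ]
  have h1 : muHat y x s j - m
      = (∑ i with y i = s, (hHat y x j (x i j) - m)) / classSize y s := by
    rw [muHat, Finset.sum_sub_distrib, Finset.sum_const, nsmul_eq_mul, sub_div]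
    congr 1
    change m = classSize y s * m / classSize y s
    field_simp
  have h2 : ∑ i with y i = s, (hHat y x j (x i j) - m)
      = (∑ i, if y i = s then z i - m else 0)
        + ∑ i with y i = s, (hHat y x j (x i j) - z i) := by
    rw [← Finset.sum_filter, ← Finset.sum_add_distrib]
    exact Finset.sum_congr rfl fun i _ => by ring
  have h3 : |∑ i with y i = s, (hHat y x j (x i j) - z i)| ≤ n * δ := by
    refine (Finset.abs_sum_le_sum_abs _ _).trans (le_trans ?_ hes)
    refine (Finset.sum_le_sum fun i _ => he i).trans ?_
    exact Finset.sum_le_sum_of_subset_of_nonneg (Finset.filter_subset _ _)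
      fun i _ _ => (abs_nonneg _).trans (he i)
  have h4 : |∑ i with y i = s, (hHat y x j (x i j) - m)| ≤ 2 * (n * δ) := by
    rw [h2]; exact (abs_add_le _ _).trans (by linarith)
  rw [h1, abs_div, abs_of_pos hN0, div_le_div_iff₀ hN0 hπ]
  have hδ : 0 ≤ δ := nonneg_of_mul_nonneg_right ((abs_nonneg _).trans hz) hn'
  nlinarith

lemma abs_mul_sub_mul_le {w w' e e' r v v' : ℝ} (hw : |w| ≤ r) (hw' : |w'| ≤ r)
    (he : |e| ≤ r * v) (he' : |e'| ≤ r * v') (hv : 0 ≤ v) (hv'1 : v' ≤ 1) :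
    |(w + e) * (w' + e') - w * w'| ≤ 2 * (r ^ 2 * v) + r ^ 2 * v' := by
  have hr : 0 ≤ r := (abs_nonneg _).trans hw
  have h : (w + e) * (w' + e') - w * w' = w * e' + (e * w' + e * e') := by ring
  rw [h]
  refine (abs_add_le _ _).trans ?_
  have h0 := abs_add_le (e * w') (e * e')
  have h1 : |w * e'| ≤ r * (r * v') := by rw [abs_mul]; gcongr
  have h2 : |e * w'| ≤ r * v * r := by rw [abs_mul]; gcongr
  have h3 : |e * e'| ≤ r * v * r := by
    rw [abs_mul]; gcongr
    exact he'.trans (mul_le_of_le_one_right hr hv'1)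
  nlinarith

lemma abs_sigmaHat_sub_le {k : Fin p} {z z' w w' r v v' : Fin n → ℝ} {m m' : ℤ → ℝ} {σ δ d π : ℝ}
    (hn : 4 ≤ n) (hy : ∀ i, y i = 1 ∨ y i = -1) (hπ : 0 < π) (hσ : |σ| ≤ 1)
    (hN : ∀ s, s = 1 ∨ s = -1 → π / 2 ≤ (classSize y s : ℝ) / n)
    (hw : ∀ i, w i = z i - m (y i)) (hw' : ∀ i, w' i = z' i - m' (y i))
    (hwr : ∀ i, |w i| ≤ r i) (hwr' : ∀ i, |w' i| ≤ r i)
    (he : ∀ i, |hHat y x j (x i j) - z i| ≤ r i * v i)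
    (he' : ∀ i, |hHat y x k (x i k) - z' i| ≤ r i * v' i)
    (hv : ∀ i, 0 ≤ v i) (hv1 : ∀ i, v' i ≤ 1)
    (hs : ∑ i, r i ^ 2 * v i ≤ n * δ) (hs' : ∑ i, r i ^ 2 * v' i ≤ n * δ)
    (hww : |∑ i, (w i * w' i - σ)| ≤ n * δ)
    (hd1 : d ≤ 1) (hd : ∀ s, s = 1 ∨ s = -1 → |muHat y x s j - m s| ≤ d)
    (hd' : ∀ s, s = 1 ∨ s = -1 → |muHat y x s k - m' s| ≤ d) :
    |sigmaHat y x j k - σ| ≤ 8 * δ + 2 * d + 4 / n := by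
  have hn' : (4 : ℝ) ≤ n := by exact_mod_cast hn
  have hn0 : (0 : ℝ) < n := by linarith
  have hd0 : 0 ≤ d := (abs_nonneg _).trans (hd 1 (Or.inl rfl))
  have hcard : ∀ s, s = 1 ∨ s = -1 → classSize y s ≠ 0 := by
    intro s hsp h0
    have := hN s hsp
    rw [h0] at this
    simp at this
    linarith
  have e1 : ∀ s, s = 1 ∨ s = -1 → ∑ i with y i = s,
      (hHat y x j (x i j) - muHat y x s j) * (hHat y x k (x i k) - muHat y x s k)
      = ∑ i with y i = s, (hHat y x j (x i j) - m (y i)) * (hHat y x k (x i k) - m' (y i))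
        - classSize y s * ((muHat y x s j - m s) * (muHat y x s k - m' s)) := by
    intro s hsp
    refine (sum_filter_sub_mean_mul_sub_mean (Finset.univ.filter fun i => y i = s) (hcard s hsp)
      (fun i => hHat y x j (x i j)) (fun i => hHat y x k (x i k)) (m s) (m' s)).trans ?_
    congr 1
    refine Finset.sum_congr rfl fun i hi => ?_
    rw [(Finset.mem_filter.1 hi).2]
  have hdisj : ∀ f : Fin n → ℝ, ∑ i with y i = 1, f i + ∑ i with y i = -1, f i = ∑ i, f i := by
    intro f
    rw [← Finset.sum_filter_add_sum_filter_not Finset.univ (fun i => y i = 1)]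
    congr 1
    refine Finset.sum_congr (Finset.filter_congr fun i _ => ?_) fun _ _ => rfl
    rcases hy i with h | h <;> simp [h]
  have hcs : (classSize y 1 : ℝ) + classSize y (-1) = n := by
    have := hdisj fun _ => 1
    simpa [classSize] using this
  have h1 : |∑ i, (hHat y x j (x i j) - m (y i)) * (hHat y x k (x i k) - m' (y i)) - n * σ|
      ≤ n * (4 * δ) := by
    have : ∑ i, (hHat y x j (x i j) - m (y i)) * (hHat y x k (x i k) - m' (y i)) - n * σ
        = ∑ i, (w i * w' i - σ) + ∑ i, ((w i + (hHat y x j (x i j) - z i))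
          * (w' i + (hHat y x k (x i k) - z' i)) - w i * w' i) := by
      rw [← Finset.sum_add_distrib]
      have hc : (n : ℝ) * σ = ∑ _i : Fin n, σ := by simp
      rw [hc, ← Finset.sum_sub_distrib]
      exact Finset.sum_congr rfl fun i _ => by rw [hw, hw']; ring
    rw [this]
    refine (abs_add_le _ _).trans ?_
    have h2 : |∑ i, ((w i + (hHat y x j (x i j) - z i))
          * (w' i + (hHat y x k (x i k) - z' i)) - w i * w' i)|
        ≤ ∑ i, (2 * (r i ^ 2 * v i) + r i ^ 2 * v' i) :=
      (Finset.abs_sum_le_sum_abs _ _).trans (Finset.sum_le_sum fun i _ =>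
        abs_mul_sub_mul_le (hwr i) (hwr' i) (he i) (he' i) (hv i) (hv1 i))
    rw [Finset.sum_add_distrib, ← Finset.mul_sum] at h2
    linarith
  have h2 : ∀ s, s = 1 ∨ s = -1 → |(muHat y x s j - m s) * (muHat y x s k - m' s)| ≤ d := by
    intro s hsp
    rw [abs_mul]
    calc _ ≤ d * 1 := mul_le_mul (hd s hsp) ((hd' s hsp).trans hd1) (abs_nonneg _) hd0
      _ = d := mul_one d
  have h2p := abs_le.1 (h2 1 (Or.inl rfl))
  have h2m := abs_le.1 (h2 (-1) (Or.inr rfl))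
  set a := (muHat y x 1 j - m 1) * (muHat y x 1 k - m' 1)
  set a' := (muHat y x (-1) j - m (-1)) * (muHat y x (-1) k - m' (-1))
  have h3 : sigmaHat y x j k = (∑ i, (hHat y x j (x i j) - m (y i)) * (hHat y x k (x i k) - m' (y i))
      - (classSize y 1 * a + classSize y (-1) * a')) / (n - 2) := by
    rw [sigmaHat, e1 1 (Or.inl rfl), e1 (-1) (Or.inr rfl), ← hdisj]
    congr 1
    ring
  have h4 : |classSize y 1 * a + classSize y (-1) * a'| ≤ n * d := by
    rw [← hcs, abs_le]
    have c1 : (0 : ℝ) ≤ classSize y 1 := by positivity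
    have c2 : (0 : ℝ) ≤ classSize y (-1) := by positivity
    constructor <;> nlinarith
  have h5 : (n : ℝ) / 2 ≤ n - 2 := by linarith
  have hpos : (0 : ℝ) < n - 2 := by linarith
  have h6 : |(n - 2 : ℝ) * (sigmaHat y x j k - σ)| ≤ n * (4 * δ) + n * d + 2 := by
    rw [h3, mul_sub, mul_div_cancel₀ _ hpos.ne']
    rw [abs_le] at h1 h4 hσ ⊢
    constructor <;> nlinarith
  rw [abs_mul, abs_of_pos hpos] at h6
  have h7 : (n : ℝ) / 2 * |sigmaHat y x j k - σ| ≤ n * (4 * δ) + n * d + 2 :=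
    (mul_le_mul_of_nonneg_right h5 (abs_nonneg _)).trans h6
  have h8 : n * (8 * δ + 2 * d + 4 / n) = 2 * (n * (4 * δ) + n * d + 2) := by field_simp; ring
  nlinarith

end Sample

end SeLDA

namespace SeLDA

section Model

variable {p : ℕ} {D : Measure (ℤ × (Fin p → ℝ))} {πp : ℝ} {h : Fin p → ℝ → ℝ}
  {μp μm : EuclideanSpace ℝ (Fin p)} {S : Matrix (Fin p) (Fin p) ℝ}

/-- The centred Gaussian score. -/
noncomputable def score (h : Fin p → ℝ → ℝ) (mp mm : Fin p → ℝ) (j : Fin p)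
    (z : ℤ × (Fin p → ℝ)) : ℝ := h j (z.2 j) - classMean mp mm z.1 j

lemma integrable_of_hasLaw_gaussian {α : Type*} [MeasurableSpace α] {ν : Measure α}
    {f : α → ℝ} (hf : HasLaw f (gaussianReal 0 1) ν) : Integrable f ν ∧ ∫ z, f z ∂ν = 0 := by
  have h1 : Integrable id (ν.map f) := by
    rw [hf.map_eq]
    exact (memLp_id_gaussianReal 1).integrable le_rfl
  refine ⟨h1.comp_aemeasurable hf.aemeasurable, ?_⟩
  rw [hf.integral_eq, integral_id_gaussianReal]

lemma measurableSet_label (s : ℤ) : MeasurableSet {z : ℤ × (Fin p → ℝ) | z.1 = s} :=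
  measurable_fst (measurableSet_singleton s)

namespace IsModel

lemma ae_label (hD : IsModel D πp h μp μm S) : ∀ᵐ z ∂D, z.1 = 1 ∨ z.1 = -1 := by
  have := hD.isProbabilityMeasure
  have hdisj : Disjoint {z : ℤ × (Fin p → ℝ) | z.1 = 1} {z | z.1 = -1} := by
    rw [Set.disjoint_left]
    intro z h1 h2
    simp only [Set.mem_ofPred_eq] at h1 h2
    omega
  have h1 : D.real ({z | z.1 = 1} ∪ {z | z.1 = -1}) = 1 := by
    rw [measureReal_union hdisj (measurableSet_label _), hD.prob_pos, hD.prob_neg]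
    ring
  have h2 := probReal_compl_eq_one_sub (μ := D)
    ((measurableSet_label (p := p) 1).union (measurableSet_label (-1)))
  rw [h1, sub_self] at h2
  rw [ae_iff]
  rw [measureReal_eq_zero_iff] at h2
  exact h2

lemma eq_mixture (hD : IsModel D πp h μp μm S) (h0 : 0 < πp) (h1 : πp < 1) :
    D = ENNReal.ofReal πp • cond D {z | z.1 = 1}
      + ENNReal.ofReal (1 - πp) • cond D {z | z.1 = -1} := by
  have := hD.isProbabilityMeasure
  have hm : ∀ (s : ℤ) (q : ℝ), 0 < q → D.real {z | z.1 = s} = q →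
      ENNReal.ofReal q • cond D {z | z.1 = s} = D.restrict {z | z.1 = s} := by
    intro s q hq hs
    have h2 : ENNReal.ofReal q = D {z | z.1 = s} := by rw [← hs, ofReal_measureReal]
    have h3 : D {z | z.1 = s} ≠ 0 := by
      rw [← h2]; exact (ENNReal.ofReal_pos.2 hq).ne'
    rw [ProbabilityTheory.cond, smul_smul, h2, ENNReal.mul_inv_cancel h3 (measure_ne_top _ _), one_smul]
  rw [hm 1 πp h0 hD.prob_pos, hm (-1) (1 - πp) (by linarith) hD.prob_neg,
    ← Measure.restrict_union _ (measurableSet_label _)]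
  · refine (Measure.restrict_eq_self_of_ae_mem ?_).symm
    exact hD.ae_label
  · rw [Set.disjoint_left]
    intro z h1 h2
    simp only [Set.mem_ofPred_eq] at h1 h2
    omega

lemma ae_cond_label (s : ℤ) : ∀ᵐ z ∂(cond D {z | z.1 = s}), z.1 = s := by
  rw [ProbabilityTheory.cond]
  exact Measure.ae_smul_measure (ae_restrict_mem (measurableSet_label s)) _

lemma isProbabilityMeasure_cond_pos (hD : IsModel D πp h μp μm S) (h0 : 0 < πp) :
    IsProbabilityMeasure (cond D {z | z.1 = 1}) := by
  have := hD.isProbabilityMeasure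
  refine cond_isProbabilityMeasure ?_
  intro hz
  have := hD.prob_pos
  rw [measureReal_def, hz] at this
  simp at this
  linarith

lemma isProbabilityMeasure_cond_neg (hD : IsModel D πp h μp μm S) (h1 : πp < 1) :
    IsProbabilityMeasure (cond D {z | z.1 = -1}) := by
  have := hD.isProbabilityMeasure
  refine cond_isProbabilityMeasure ?_
  intro hz
  have := hD.prob_neg
  rw [measureReal_def, hz] at this
  simp at this
  linarith

lemma hasLaw_coord {ν : Measure (ℤ × (Fin p → ℝ))} {m : EuclideanSpace ℝ (Fin p)}
    (hS : S.PosSemidef) (hS1 : ∀ j, S j j = 1)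
    (hlaw : HasLaw (fun z : ℤ × (Fin p → ℝ) => WithLp.toLp 2 fun j => h j (z.2 j))
      (multivariateGaussian m S) ν) (j : Fin p) :
    HasLaw (fun z : ℤ × (Fin p → ℝ) => h j (z.2 j)) (gaussianReal (m j) 1) ν := by
  have := (measurePreserving_eval_multivariateGaussian (μ := m) hS (i := j)).hasLaw.comp hlaw
  rw [hS1, Real.toNNReal_one] at this
  exact this

lemma hasLaw_pos (hD : IsModel D πp h μp μm S) (j : Fin p) :
    HasLaw (fun z : ℤ × (Fin p → ℝ) => h j (z.2 j)) (gaussianReal (μp j) 1)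
      (cond D {z | z.1 = 1}) := hasLaw_coord hD.posSemidef hD.diag_one hD.law_pos j

lemma hasLaw_neg (hD : IsModel D πp h μp μm S) (j : Fin p) :
    HasLaw (fun z : ℤ × (Fin p → ℝ) => h j (z.2 j)) (gaussianReal (μm j) 1)
      (cond D {z | z.1 = -1}) := hasLaw_coord hD.posSemidef hD.diag_one hD.law_neg j

lemma aemeasurable_coord (hD : IsModel D πp h μp μm S) (h0 : 0 < πp) (h1 : πp < 1) (j : Fin p) :
    AEMeasurable (fun z : ℤ × (Fin p → ℝ) => h j (z.2 j)) D := by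
  rw [hD.eq_mixture h0 h1, aemeasurable_add_measure_iff]
  exact ⟨(hD.hasLaw_pos j).aemeasurable.smul_measure _,
    (hD.hasLaw_neg j).aemeasurable.smul_measure _⟩

/-- Bounds valid in both classes are valid for the mixture. -/
lemma lintegral_le (hD : IsModel D πp h μp μm S) (h0 : 0 < πp) (h1 : πp < 1)
    {f : ℤ × (Fin p → ℝ) → ENNReal} {B : ENNReal}
    (hp : ∫⁻ z, f z ∂(cond D {z | z.1 = 1}) ≤ B) (hm : ∫⁻ z, f z ∂(cond D {z | z.1 = -1}) ≤ B) :
    ∫⁻ z, f z ∂D ≤ B := by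
  conv_lhs => rw [hD.eq_mixture h0 h1]
  rw [lintegral_add_measure, lintegral_smul_measure, lintegral_smul_measure]
  calc _ ≤ ENNReal.ofReal πp * B + ENNReal.ofReal (1 - πp) * B := by
        simp only [smul_eq_mul]; gcongr
    _ = B := by
        rw [← add_mul, ← ENNReal.ofReal_add h0.le (by linarith)]
        simp

lemma lintegral_comp_coord_le (hD : IsModel D πp h μp μm S) (h0 : 0 < πp) (h1 : πp < 1)
    {M : ℝ} (hM : 0 ≤ M) (hμ : ∀ j, |μm j| ≤ M) {g : ℝ → ENNReal} (hg : Measurable g)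
    {B : ENNReal} (hB : ∀ m, |m| ≤ M → ∫⁻ t, g t ∂(gaussianReal m 1) ≤ B) (j : Fin p) :
    ∫⁻ z, g (h j (z.2 j)) ∂D ≤ B := by
  refine hD.lintegral_le h0 h1 ?_ ?_
  · rw [(hD.hasLaw_pos j).lintegral_comp hg.aemeasurable]
    exact hB _ (by simpa [hD.mean_pos] using hM)
  · rw [(hD.hasLaw_neg j).lintegral_comp hg.aemeasurable]
    exact hB _ (hμ j)

lemma score_ae_eq_pos (mp mm : Fin p → ℝ) (j : Fin p) :
    score h mp mm j =ᵐ[cond D {z | z.1 = 1}] fun z => h j (z.2 j) - mp j := by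
  filter_upwards [ae_cond_label 1] with z hz
  simp [score, classMean, hz]

lemma score_ae_eq_neg (mp mm : Fin p → ℝ) (j : Fin p) :
    score h mp mm j =ᵐ[cond D {z | z.1 = -1}] fun z => h j (z.2 j) - mm j := by
  filter_upwards [ae_cond_label (-1)] with z hz
  simp [score, classMean, hz]

lemma hasLaw_score_pos (hD : IsModel D πp h μp μm S) (j : Fin p) :
    HasLaw (score h μp μm j) (gaussianReal 0 1) (cond D {z | z.1 = 1}) := by
  have := (gaussianReal_sub_const (hD.hasLaw_pos j) (μp j))
  rw [sub_self] at this
  exact this.congr (score_ae_eq_pos _ _ j)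

lemma hasLaw_score_neg (hD : IsModel D πp h μp μm S) (j : Fin p) :
    HasLaw (score h μp μm j) (gaussianReal 0 1) (cond D {z | z.1 = -1}) := by
  have := (gaussianReal_sub_const (hD.hasLaw_neg j) (μm j))
  rw [sub_self] at this
  exact this.congr (score_ae_eq_neg _ _ j)

lemma aemeasurable_score (hD : IsModel D πp h μp μm S) (h0 : 0 < πp) (h1 : πp < 1) (j : Fin p) :
    AEMeasurable (score h μp μm j) D := by
  rw [hD.eq_mixture h0 h1, aemeasurable_add_measure_iff]
  exact ⟨(hD.hasLaw_score_pos j).aemeasurable.smul_measure _,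
    (hD.hasLaw_score_neg j).aemeasurable.smul_measure _⟩

lemma lintegral_comp_score_le (hD : IsModel D πp h μp μm S) (h0 : 0 < πp) (h1 : πp < 1)
    {g : ℝ → ENNReal} (hg : Measurable g) {B : ENNReal}
    (hB : ∫⁻ t, g t ∂(gaussianReal 0 1) ≤ B) (j : Fin p) :
    ∫⁻ z, g (score h μp μm j z) ∂D ≤ B := by
  refine hD.lintegral_le h0 h1 ?_ ?_
  · rwa [(hD.hasLaw_score_pos j).lintegral_comp hg.aemeasurable]
  · rwa [(hD.hasLaw_score_neg j).lintegral_comp hg.aemeasurable]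

lemma integral_mixture (hD : IsModel D πp h μp μm S) (h0 : 0 < πp) (h1 : πp < 1)
    {f : ℤ × (Fin p → ℝ) → ℝ} (hp : Integrable f (cond D {z | z.1 = 1}))
    (hm : Integrable f (cond D {z | z.1 = -1})) :
    ∫ z, f z ∂D = πp * ∫ z, f z ∂(cond D {z | z.1 = 1})
      + (1 - πp) * ∫ z, f z ∂(cond D {z | z.1 = -1}) := by
  conv_lhs => rw [hD.eq_mixture h0 h1]
  rw [integral_add_measure (hp.smul_measure (by simp)) (hm.smul_measure (by simp)),
    integral_smul_measure, integral_smul_measure, ENNReal.toReal_ofReal h0.le,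
    ENNReal.toReal_ofReal (by linarith), smul_eq_mul, smul_eq_mul]

lemma integral_score_mul_indicator (hD : IsModel D πp h μp μm S) (h0 : 0 < πp) (h1 : πp < 1)
    {s : ℤ} (hs : s = 1 ∨ s = -1) (j : Fin p) :
    ∫ z, (if z.1 = s then score h μp μm j z else 0) ∂D = 0 := by
  obtain ⟨ip, zp⟩ := integrable_of_hasLaw_gaussian (hD.hasLaw_score_pos j)
  obtain ⟨im, zm⟩ := integrable_of_hasLaw_gaussian (hD.hasLaw_score_neg j)
  rcases hs with rfl | rfl
  · have e1 : (fun z : ℤ × (Fin p → ℝ) => if z.1 = 1 then score h μp μm j z else 0)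
        =ᵐ[cond D {z | z.1 = 1}] score h μp μm j := by
      filter_upwards [ae_cond_label 1] with z hz
      simp [hz]
    have e2 : (fun z : ℤ × (Fin p → ℝ) => if z.1 = 1 then score h μp μm j z else 0)
        =ᵐ[cond D {z | z.1 = -1}] 0 := by
      filter_upwards [ae_cond_label (-1)] with z hz
      simp [hz]
    rw [hD.integral_mixture h0 h1 (ip.congr e1.symm) ((integrable_zero _ _ _).congr e2.symm),
      integral_congr_ae e1, integral_congr_ae e2, zp]
    simp
  · have e1 : (fun z : ℤ × (Fin p → ℝ) => if z.1 = -1 then score h μp μm j z else 0)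
        =ᵐ[cond D {z | z.1 = -1}] score h μp μm j := by
      filter_upwards [ae_cond_label (-1)] with z hz
      simp [hz]
    have e2 : (fun z : ℤ × (Fin p → ℝ) => if z.1 = -1 then score h μp μm j z else 0)
        =ᵐ[cond D {z | z.1 = 1}] 0 := by
      filter_upwards [ae_cond_label 1] with z hz
      simp [hz]
    rw [hD.integral_mixture h0 h1 ((integrable_zero _ _ _).congr e2.symm)
        (im.congr e1.symm),
      integral_congr_ae e1, integral_congr_ae e2, zm]
    simp

lemma integral_centred_mul {ν : Measure (ℤ × (Fin p → ℝ))} [IsProbabilityMeasure ν]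
    {m : EuclideanSpace ℝ (Fin p)} (hS : S.PosSemidef) (hS1 : ∀ j, S j j = 1)
    (hlaw : HasLaw (fun z : ℤ × (Fin p → ℝ) => WithLp.toLp 2 fun j => h j (z.2 j))
      (multivariateGaussian m S) ν) (j k : Fin p) :
    ∫ z, (h j (z.2 j) - m j) * (h k (z.2 k) - m k) ∂ν = S j k := by
  have hcov := covariance_eval_multivariateGaussian (μ := m) hS j k
  rw [← hlaw.covariance_fun_comp (f := fun x => x j) (g := fun x => x k)
    (by fun_prop) (by fun_prop), covariance] at hcov
  have hj := hasLaw_coord hS hS1 hlaw j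
  have hk := hasLaw_coord hS hS1 hlaw k
  rw [← hcov]
  have e1 : ∫ z, h j (z.2 j) ∂ν = m j := by rw [hj.integral_eq, integral_id_gaussianReal]
  have e2 : ∫ z, h k (z.2 k) ∂ν = m k := by rw [hk.integral_eq, integral_id_gaussianReal]
  simp only [e1, e2]

lemma integrable_mul_of_hasLaw {α : Type*} [MeasurableSpace α] {ν : Measure α}
    {f g : α → ℝ} (hf : HasLaw f (gaussianReal 0 1) ν) (hg : HasLaw g (gaussianReal 0 1) ν) :
    Integrable (fun z => f z * g z) ν := by
  have key : ∀ {f : α → ℝ}, HasLaw f (gaussianReal 0 1) ν → MemLp f 2 ν := by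
    intro f hf
    have h1 : MemLp id 2 (ν.map f) := by
      rw [hf.map_eq]; exact memLp_id_gaussianReal 2
    exact (memLp_map_measure_iff (by fun_prop) hf.aemeasurable).1 h1
  exact (key hf).integrable_mul (key hg)

lemma integral_score_mul_score (hD : IsModel D πp h μp μm S) (h0 : 0 < πp) (h1 : πp < 1)
    (j k : Fin p) : ∫ z, (score h μp μm j z * score h μp μm k z) ∂D = S j k := by
  have := hD.isProbabilityMeasure_cond_pos h0
  have := hD.isProbabilityMeasure_cond_neg h1
  rw [hD.integral_mixture h0 h1
    (integrable_mul_of_hasLaw (hD.hasLaw_score_pos j) (hD.hasLaw_score_pos k))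
    (integrable_mul_of_hasLaw (hD.hasLaw_score_neg j) (hD.hasLaw_score_neg k))]
  have e1 := integral_centred_mul hD.posSemidef hD.diag_one hD.law_pos j k
  have e2 := integral_centred_mul hD.posSemidef hD.diag_one hD.law_neg j k
  have c1 := integral_congr_ae
    ((score_ae_eq_pos (D := D) (h := h) μp μm j).mul (score_ae_eq_pos (D := D) (h := h) μp μm k))
  have c2 := integral_congr_ae
    ((score_ae_eq_neg (D := D) (h := h) μp μm j).mul (score_ae_eq_neg (D := D) (h := h) μp μm k))
  simp only [Pi.mul_apply] at c1 c2
  rw [c1, c2, e1, e2]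
  ring

lemma abs_cov_le_one (hD : IsModel D πp h μp μm S) (j k : Fin p) : |S j k| ≤ 1 := by
  have hd := hD.posSemidef
  have hsymm : S k j = S j k := by simpa using hd.1.apply j k
  have key : ∀ t : ℝ, 0 ≤ 1 + 2 * t * S j k + t ^ 2 := by
    intro t
    have := hd.dotProduct_mulVec_nonneg (Pi.single j 1 + t • Pi.single k 1)
    simp [Matrix.mulVec_add, add_dotProduct, dotProduct_add, Matrix.mulVec_smul, hD.diag_one,
      hsymm] at this
    linarith
  rw [abs_le]
  constructor
  · linarith [key 1]
  · linarith [key (-1)]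

lemma integral_indicator_le (hD : IsModel D πp h μp μm S) (h0 : 0 < πp) (h1 : πp < 1)
    (q : ℝ) (j : Fin p) :
    ∫ z, (if z.1 = 1 ∧ h j (z.2 j) ≤ q then (1 : ℝ) else 0) ∂D = πp * normalCdf q := by
  have := hD.isProbabilityMeasure_cond_pos h0
  have e1 : (fun z : ℤ × (Fin p → ℝ) => if z.1 = 1 ∧ h j (z.2 j) ≤ q then (1 : ℝ) else 0)
      =ᵐ[cond D {z | z.1 = 1}] fun z => (Set.Iic q).indicator 1 (h j (z.2 j)) := by
    filter_upwards [ae_cond_label 1] with z hz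
    simp [hz, Set.indicator_apply]
  have e2 : (fun z : ℤ × (Fin p → ℝ) => if z.1 = 1 ∧ h j (z.2 j) ≤ q then (1 : ℝ) else 0)
      =ᵐ[cond D {z | z.1 = -1}] 0 := by
    filter_upwards [ae_cond_label (-1)] with z hz
    simp [hz]
  have hl := hD.hasLaw_pos j
  rw [hD.mean_pos] at hl
  have hm : Measurable ((Set.Iic q).indicator (1 : ℝ → ℝ)) :=
    measurable_one.indicator measurableSet_Iic
  have hint : Integrable (fun z : ℤ × (Fin p → ℝ) => (Set.Iic q).indicator (1 : ℝ → ℝ) (h j (z.2 j)))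
      (cond D {z | z.1 = 1}) := by
    refine Integrable.of_bound (hm.comp_aemeasurable hl.aemeasurable).aestronglyMeasurable 1
      (Filter.Eventually.of_forall fun z => ?_)
    simp only [Set.indicator_apply, Pi.one_apply]
    split_ifs <;> simp
  rw [hD.integral_mixture h0 h1 (hint.congr e1.symm) ((integrable_zero _ _ _).congr e2.symm),
      integral_congr_ae e1, integral_congr_ae e2]
  have := hl.integral_comp (f := (Set.Iic q).indicator (1 : ℝ → ℝ)) hm.aestronglyMeasurable
  simp only [Function.comp_def] at this
  rw [this, integral_indicator_one measurableSet_Iic, normalCdf, cdf_eq_real]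
  simp

lemma integral_indicator_label (hD : IsModel D πp h μp μm S) (s : ℤ) :
    ∫ z, (if z.1 = s then (1 : ℝ) else 0) ∂D = D.real {z | z.1 = s} := by
  have := hD.isProbabilityMeasure
  rw [← integral_indicator_one (measurableSet_label s)]
  simp [Set.indicator_apply]

end IsModel

end Model

end SeLDA

namespace SeLDA

lemma tailWeight_le_rpow {η a : ℝ} (hη : 0 ≤ η) (ha0 : 0 ≤ a) (ha1 : a ≤ 1) (z : ℝ) :
    tailWeight η z ≤ (3 * η) ^ a * Real.exp (a * (|z| + 1) ^ 2 / 2) := by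
  unfold tailWeight
  have h : (3 * η) ^ a * Real.exp (a * (|z| + 1) ^ 2 / 2)
      = (3 * η * Real.exp ((|z| + 1) ^ 2 / 2)) ^ a := by
    rw [Real.mul_rpow (x := 3 * η) (by positivity) (Real.exp_pos _).le, ← Real.exp_mul]
    congr 2; ring
  rw [h]
  set x := 3 * η * Real.exp ((|z| + 1) ^ 2 / 2)
  have hx : 0 ≤ x := by positivity
  rcases le_total 1 x with h1 | h1
  · exact (min_le_left _ _).trans (Real.one_le_rpow h1 ha0)
  · refine (min_le_right _ _).trans ?_
    rcases hx.eq_or_lt with h0 | h0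
    · rw [← h0]; positivity
    · exact Real.self_le_rpow_of_le_one h0.le h1 ha1

lemma measurable_tailWeight (η : ℝ) : Measurable (tailWeight η) := by
  unfold tailWeight; fun_prop

/-- The quadratic envelope of a pair of Gaussian scores. -/
noncomputable def envelope (b u v : ℝ) : ℝ := b + |u| + |v|

lemma exp_envelope_mul_tailWeight_le {b s N η u v : ℝ} (hb : 1 ≤ b) (hs : 0 ≤ s)
    (hsb : 8 * (1 + s) ≤ b ^ 2) (hN : 0 < N) (hsN : Real.log N = s * Real.log b) (hη : 0 ≤ η) :
    Real.exp (envelope b u v ^ 2 * tailWeight η u / (6 * b ^ 2))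
      ≤ 1 + (3 / (2 * N) * Real.exp (1 / 2 * (|u| + 1) ^ 2 / 2)
        + (3 / (2 * N) * Real.exp (1 / 2 * (|v| + 1) ^ 2 / 2) + 3 * b * tailWeight η u)) := by
  set w := tailWeight η u with hw
  have hw0 : 0 ≤ w := tailWeight_nonneg hη u
  have hw1 : w ≤ 1 := tailWeight_le_one η u
  have hb0 : 0 < b := by linarith
  set g := envelope b u v ^ 2 / (6 * b ^ 2) with hg
  have hg0 : 0 ≤ g := by positivity
  have hf : envelope b u v ^ 2 * w / (6 * b ^ 2) = g * w := by rw [hg]; ring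
  rw [hf]
  set Y := (u ^ 2 + v ^ 2) / b ^ 2 with hY
  have hgw : g * w ≤ g := mul_le_of_le_one_right hg0 hw1
  have h2g : 2 * g ≤ 1 + Y := by
    rw [hg, hY, envelope, ← sq_abs u, ← sq_abs v]
    rw [show 1 + (|u| ^ 2 + |v| ^ 2) / b ^ 2 = (b ^ 2 + |u| ^ 2 + |v| ^ 2) / b ^ 2 by field_simp; ring,
      show 2 * ((b + |u| + |v|) ^ 2 / (6 * b ^ 2)) = ((b + |u| + |v|) ^ 2 / 3) / b ^ 2 by
        field_simp; ring]
    gcongr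
    nlinarith [sq_nonneg (b - |u|), sq_nonneg (b - |v|), sq_nonneg (|u| - |v|)]
  have h1 : Real.exp (g * w) ≤ 1 + w * Real.exp (1 + Y) := by
    have e1 : Real.exp (g * w) ≤ 1 + g * w * Real.exp (g * w) := by
      have := Real.add_one_le_exp (-(g * w))
      have h3 : Real.exp (-(g * w)) * Real.exp (g * w) = 1 := by rw [← Real.exp_add]; simp
      nlinarith [Real.exp_pos (g * w)]
    have e2 : g * Real.exp (g * w) ≤ Real.exp (1 + Y) := by
      calc g * Real.exp (g * w) ≤ Real.exp g * Real.exp g := by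
            gcongr
            linarith [Real.add_one_le_exp g]
        _ = Real.exp (2 * g) := by rw [← Real.exp_add]; ring_nf
        _ ≤ _ := Real.exp_le_exp.2 h2g
    nlinarith
  have h3 : w * Real.exp Y ≤ Real.exp ((1 + s) * Y) / N + b * w := by
    rcases le_total Y (Real.log b) with hYb | hYb
    · have : Real.exp Y ≤ b := by rw [← Real.exp_log hb0]; exact Real.exp_le_exp.2 hYb
      have : 0 ≤ Real.exp ((1 + s) * Y) / N := by positivity
      nlinarith
    · have : Real.exp Y ≤ Real.exp ((1 + s) * Y) / N := by
        rw [le_div_iff₀ hN, ← Real.exp_log hN, ← Real.exp_add, hsN]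
        refine Real.exp_le_exp.2 ?_
        nlinarith
      have h5 : w * Real.exp Y ≤ Real.exp Y := mul_le_of_le_one_left (Real.exp_pos _).le hw1
      have : 0 ≤ b * w := by positivity
      linarith
  have h4 : Real.exp ((1 + s) * Y) ≤ (Real.exp (1 / 2 * (|u| + 1) ^ 2 / 2)
      + Real.exp (1 / 2 * (|v| + 1) ^ 2 / 2)) / 2 := by
    have e1 : (1 + s) * Y ≤ u ^ 2 / 8 + v ^ 2 / 8 := by
      have : (1 + s) / b ^ 2 ≤ 1 / 8 := by
        rw [div_le_iff₀ (by positivity)]; linarith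
      have e2 : (1 + s) * Y = (1 + s) / b ^ 2 * (u ^ 2 + v ^ 2) := by rw [hY]; ring
      rw [e2]
      have := mul_le_mul_of_nonneg_right this (by positivity : 0 ≤ u ^ 2 + v ^ 2)
      linarith
    have e3 : ∀ x : ℝ, Real.exp (x ^ 2 / 8) ^ 2 ≤ Real.exp (1 / 2 * (|x| + 1) ^ 2 / 2) := by
      intro x
      rw [← Real.exp_nat_mul]
      refine Real.exp_le_exp.2 ?_
      push_cast
      nlinarith [sq_abs x, abs_nonneg x]
    have e4 : Real.exp ((1 + s) * Y) ≤ Real.exp (u ^ 2 / 8) * Real.exp (v ^ 2 / 8) := by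
      rw [← Real.exp_add]; exact Real.exp_le_exp.2 e1
    nlinarith [e3 u, e3 v, sq_nonneg (Real.exp (u ^ 2 / 8) - Real.exp (v ^ 2 / 8))]
  have h5 : w * Real.exp (1 + Y) ≤ 3 * (w * Real.exp Y) := by
    rw [Real.exp_add]
    have := Real.exp_one_lt_d9
    have h6 : 0 ≤ w * Real.exp Y := by positivity
    nlinarith
  have h7 : Real.exp ((1 + s) * Y) / N ≤ (Real.exp (1 / 2 * (|u| + 1) ^ 2 / 2)
      + Real.exp (1 / 2 * (|v| + 1) ^ 2 / 2)) / 2 / N := by gcongr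
  have h8 : 3 / (2 * N) * Real.exp (1 / 2 * (|u| + 1) ^ 2 / 2)
        + (3 / (2 * N) * Real.exp (1 / 2 * (|v| + 1) ^ 2 / 2) + 3 * b * w)
      = 3 * ((Real.exp (1 / 2 * (|u| + 1) ^ 2 / 2)
      + Real.exp (1 / 2 * (|v| + 1) ^ 2 / 2)) / 2 / N + b * w) := by field_simp; ring
  rw [h8]
  linarith

section Events

variable {n p : ℕ} {D : Measure (ℤ × (Fin p → ℝ))} {πp : ℝ} {h : Fin p → ℝ → ℝ}
  {μp μm : EuclideanSpace ℝ (Fin p)} {S : Matrix (Fin p) (Fin p) ℝ}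
  {Ω : Type*} [MeasurableSpace Ω] {P : Measure Ω} [IsProbabilityMeasure P]
  {ξ : Fin n → Ω → ℤ × (Fin p → ℝ)}

/-- `K` bounds the quarter-exponential square moments of the normal laws with mean at most `M`. -/
def GaussianMomentBound (M K : ℝ) : Prop :=
  ∀ m : ℝ, |m| ≤ M → ∫⁻ z, ENNReal.ofReal (Real.exp (1 / 2 * (|z| + 1) ^ 2 / 2)) ∂(gaussianReal m 1)
        ≤ ENNReal.ofReal K

lemma measureReal_sum_gt_le_of_abs_le_one [IsProbabilityMeasure D] {f : ℤ × (Fin p → ℝ) → ℝ}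
    (hξ : ∀ i, HasLaw (ξ i) D P)
    (hind : iIndepFun ξ P) (hf : AEMeasurable f D) (h0 : ∀ z, 0 ≤ f z) (h1 : ∀ z, f z ≤ 1)
    {τ : ℝ} (hτ0 : 0 < τ) (hτ1 : τ ≤ 1) :
    P.real {ω | n * τ < |∑ i, (f (ξ i ω) - ∫ z, f z ∂D)|} ≤ 2 * Real.exp (-(n * τ ^ 2 / 96)) := by
  have hint : Integrable f D := Integrable.of_bound hf.aestronglyMeasurable 1
    (Filter.Eventually.of_forall fun z => by
      rw [Real.norm_eq_abs, abs_of_nonneg (h0 z)]; exact h1 z)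
  have hE0 : 0 ≤ ∫ z, f z ∂D := integral_nonneg h0
  have hE1 : ∫ z, f z ∂D ≤ 1 := by
    calc ∫ z, f z ∂D ≤ ∫ _z, (1 : ℝ) ∂D := integral_mono hint (integrable_const 1) h1
      _ = 1 := by simp
  have := measureReal_sum_gt_le_exp hξ hind (f := fun z => f z - ∫ z, f z ∂D)
    (hf.sub_const _) (by rw [integral_sub hint (integrable_const _)]; simp) (K := 3) ?_ hτ0 hτ1
  · convert this using 4
    ring
  · calc ∫⁻ z, ENNReal.ofReal (Real.exp |f z - ∫ z, f z ∂D|) ∂D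
        ≤ ∫⁻ _z, ENNReal.ofReal 3 ∂D := by
          refine lintegral_mono fun z => ENNReal.ofReal_le_ofReal ?_
          have : |f z - ∫ z, f z ∂D| ≤ 1 := abs_le.2 ⟨by linarith [h0 z], by linarith [h1 z]⟩
          linarith [Real.exp_le_exp.2 this, Real.exp_one_lt_d9]
      _ = _ := by simp

namespace IsModel

lemma measureReal_classSize_gt_le (hD : IsModel D πp h μp μm S)
    (hξ : ∀ i, HasLaw (ξ i) D P) (hind : iIndepFun ξ P) (s : ℤ)
    {τ : ℝ} (hτ0 : 0 < τ) (hτ1 : τ ≤ 1) :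
    P.real {ω | n * τ < |∑ i, ((if (ξ i ω).1 = s then (1 : ℝ) else 0) - D.real {z | z.1 = s})|}
      ≤ 2 * Real.exp (-(n * τ ^ 2 / 96)) := by
  have := hD.isProbabilityMeasure
  rw [← hD.integral_indicator_label s]
  refine measureReal_sum_gt_le_of_abs_le_one (f := fun z => if z.1 = s then (1 : ℝ) else 0)
    hξ hind ?_ (fun z => ?_) (fun z => ?_) hτ0 hτ1
  · exact (Measurable.ite (measurableSet_label s) measurable_const measurable_const).aemeasurable
  · split_ifs <;> norm_num
  · split_ifs <;> norm_num

lemma measureReal_count_gt_le (hD : IsModel D πp h μp μm S) (h0 : 0 < πp) (h1 : πp < 1)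
    (hξ : ∀ i, HasLaw (ξ i) D P) (hind : iIndepFun ξ P) (q : ℝ) (j : Fin p)
    {τ : ℝ} (hτ0 : 0 < τ) (hτ1 : τ ≤ 1) :
    P.real {ω | n * τ < |∑ i, ((if (ξ i ω).1 = 1 ∧ h j ((ξ i ω).2 j) ≤ q then (1 : ℝ) else 0)
        - πp * normalCdf q)|} ≤ 2 * Real.exp (-(n * τ ^ 2 / 96)) := by
  have := hD.isProbabilityMeasure
  rw [← hD.integral_indicator_le h0 h1 q j]
  refine measureReal_sum_gt_le_of_abs_le_one
    (f := fun z => if z.1 = 1 ∧ h j (z.2 j) ≤ q then (1 : ℝ) else 0)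
    hξ hind ?_ (fun z => ?_) (fun z => ?_) hτ0 hτ1
  · have hm : Measurable (fun z : ℤ × ℝ => if z.1 = 1 ∧ z.2 ≤ q then (1 : ℝ) else 0) :=
      Measurable.ite ((measurable_fst (measurableSet_singleton 1)).inter
        (measurable_snd measurableSet_Iic)) measurable_const measurable_const
    exact hm.comp_aemeasurable
      (measurable_fst.aemeasurable.prodMk (hD.aemeasurable_coord h0 h1 j))
  · split_ifs <;> norm_num
  · split_ifs <;> norm_num

lemma measureReal_score_gt_le (hD : IsModel D πp h μp μm S) (h0 : 0 < πp) (h1 : πp < 1)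
    (hξ : ∀ i, HasLaw (ξ i) D P) (hind : iIndepFun ξ P) {s : ℤ} (hs : s = 1 ∨ s = -1) (j : Fin p)
    {M K : ℝ} (hM : 0 ≤ M) (hK : GaussianMomentBound M K) {δ : ℝ} (hδ0 : 0 < δ) (hδ1 : δ ≤ 1) :
    P.real {ω | n * δ < |∑ i, (if (ξ i ω).1 = s then score h μp μm j (ξ i ω) else 0)|}
      ≤ 2 * Real.exp (-(n * δ ^ 2 / (32 * (3 * K)))) := by
  have := hD.isProbabilityMeasure
  have hm : AEMeasurable (fun z => if z.1 = s then score h μp μm j z else 0) D := by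
    have := (hD.aemeasurable_score h0 h1 j).indicator (measurableSet_label s)
    exact this.congr (Filter.Eventually.of_forall fun z => by simp [Set.indicator_apply])
  refine measureReal_sum_gt_le_exp hξ hind hm (hD.integral_score_mul_indicator h0 h1 hs j) ?_
    hδ0 hδ1
  calc ∫⁻ z, ENNReal.ofReal (Real.exp |if z.1 = s then score h μp μm j z else 0|) ∂D
      ≤ ∫⁻ z, ENNReal.ofReal 3 * ENNReal.ofReal
          (Real.exp (1 / 2 * (|score h μp μm j z| + 1) ^ 2 / 2)) ∂D := by
        refine lintegral_mono fun z => ?_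
        rw [← ENNReal.ofReal_mul (by norm_num)]
        refine ENNReal.ofReal_le_ofReal ?_
        have e1 : |if z.1 = s then score h μp μm j z else 0| ≤ |score h μp μm j z| := by
          split_ifs <;> simp
        set u := |score h μp μm j z|
        have hu : 0 ≤ u := abs_nonneg _
        have e2 : u ≤ 1 + 1 / 2 * (u + 1) ^ 2 / 2 := by nlinarith [sq_nonneg (u - 1)]
        calc Real.exp |if z.1 = s then score h μp μm j z else 0| ≤ Real.exp u :=
              Real.exp_le_exp.2 e1
          _ ≤ Real.exp (1 + 1 / 2 * (u + 1) ^ 2 / 2) := Real.exp_le_exp.2 e2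
          _ ≤ _ := by
              rw [Real.exp_add]
              gcongr
              linarith [Real.exp_one_lt_d9]
    _ ≤ ENNReal.ofReal 3 * ENNReal.ofReal K := by
        rw [lintegral_const_mul' _ _ (by simp)]
        gcongr
        exact hD.lintegral_comp_score_le h0 h1
          (g := fun t => ENNReal.ofReal (Real.exp (1 / 2 * (|t| + 1) ^ 2 / 2))) (by fun_prop)
          (hK 0 (by simpa using hM)) j
    _ = _ := by rw [← ENNReal.ofReal_mul (by norm_num)]

lemma measureReal_score_mul_gt_le (hD : IsModel D πp h μp μm S) (h0 : 0 < πp) (h1 : πp < 1)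
    (hξ : ∀ i, HasLaw (ξ i) D P) (hind : iIndepFun ξ P) (j k : Fin p)
    {M K : ℝ} (hM : 0 ≤ M) (hK : GaussianMomentBound M K) {δ : ℝ} (hδ0 : 0 < δ) (hδ1 : δ ≤ 1) :
    P.real {ω | n * δ < |∑ i, (score h μp μm j (ξ i ω) * score h μp μm k (ξ i ω) - S j k)|}
      ≤ 2 * Real.exp (-(n * (δ / 4) ^ 2 / (32 * (3 * K)))) := by
  have := hD.isProbabilityMeasure
  have hmj := hD.aemeasurable_score h0 h1 j
  have hmk := hD.aemeasurable_score h0 h1 k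
  have hσ := hD.abs_cov_le_one j k
  set f : ℤ × (Fin p → ℝ) → ℝ := fun z => (score h μp μm j z * score h μp μm k z - S j k) / 4
  have hexp : ∫⁻ z, ENNReal.ofReal (Real.exp |f z|) ∂D ≤ ENNReal.ofReal (3 * K) := by
    calc ∫⁻ z, ENNReal.ofReal (Real.exp |f z|) ∂D
        ≤ ∫⁻ z, (ENNReal.ofReal (3 / 2) * ENNReal.ofReal
            (Real.exp (1 / 2 * (|score h μp μm j z| + 1) ^ 2 / 2)) + ENNReal.ofReal (3 / 2)
            * ENNReal.ofReal (Real.exp (1 / 2 * (|score h μp μm k z| + 1) ^ 2 / 2))) ∂D := by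
          refine lintegral_mono fun z => ?_
          rw [← ENNReal.ofReal_mul (by norm_num), ← ENNReal.ofReal_mul (by norm_num),
            ← ENNReal.ofReal_add (by positivity) (by positivity)]
          refine ENNReal.ofReal_le_ofReal ?_
          set u := score h μp μm j z
          set v := score h μp μm k z
          have e1 : |f z| ≤ 1 + (u ^ 2 / 8 + v ^ 2 / 8) := by
            simp only [f]
            rw [abs_div, div_le_iff₀ (by norm_num)]
            refine (abs_sub _ _).trans ?_
            rw [abs_mul]
            norm_num
            nlinarith [sq_abs u, sq_abs v, sq_nonneg (|u| - |v|)]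
          have e3 : ∀ x : ℝ, Real.exp (x ^ 2 / 8) ^ 2 ≤ Real.exp (1 / 2 * (|x| + 1) ^ 2 / 2) := by
            intro x
            rw [← Real.exp_nat_mul]
            refine Real.exp_le_exp.2 ?_
            push_cast
            nlinarith [sq_abs x, abs_nonneg x]
          have e4 : Real.exp |f z| ≤ 3 * (Real.exp (u ^ 2 / 8) * Real.exp (v ^ 2 / 8)) := by
            rw [← Real.exp_add]
            refine (Real.exp_le_exp.2 e1).trans ?_
            rw [Real.exp_add]
            gcongr
            linarith [Real.exp_one_lt_d9]
          nlinarith [e3 u, e3 v, sq_nonneg (Real.exp (u ^ 2 / 8) - Real.exp (v ^ 2 / 8))]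
      _ ≤ ENNReal.ofReal (3 / 2) * ENNReal.ofReal K + ENNReal.ofReal (3 / 2) * ENNReal.ofReal K := by
          rw [lintegral_add_left' (by fun_prop), lintegral_const_mul' _ _ (by simp),
            lintegral_const_mul' _ _ (by simp)]
          have key := fun l => hD.lintegral_comp_score_le h0 h1
            (g := fun t => ENNReal.ofReal (Real.exp (1 / 2 * (|t| + 1) ^ 2 / 2))) (by fun_prop)
            (hK 0 (by simpa using hM)) l
          gcongr
          · exact key j
          · exact key k
      _ = _ := by
          rw [← add_mul, ← ENNReal.ofReal_add (by norm_num) (by norm_num),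
            ← ENNReal.ofReal_mul (by norm_num)]
          norm_num
  have hint : Integrable (fun z => score h μp μm j z * score h μp μm k z) D := by
    have hfi : Integrable f D := by
      have hfm : AEMeasurable f D := by fun_prop
      have hexp' : Integrable (fun z => Real.exp |f z|) D := by
        refine ⟨hfm.norm.exp.aestronglyMeasurable, ?_⟩
        rw [hasFiniteIntegral_iff_ofReal (Filter.Eventually.of_forall fun ω => by positivity)]
        exact hexp.trans_lt ENNReal.ofReal_lt_top
      refine hexp'.mono' hfm.aestronglyMeasurable (Filter.Eventually.of_forall fun z => ?_)
      rw [Real.norm_eq_abs]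
      linarith [Real.add_one_le_exp |f z|]
    refine ((hfi.const_mul 4).add (integrable_const (S j k))).congr
      (Filter.Eventually.of_forall fun z => ?_)
    simp only [Pi.add_apply, f]
    ring
  have hmean : ∫ z, f z ∂D = 0 := by
    simp only [f]
    rw [integral_div, integral_sub hint (integrable_const _), hD.integral_score_mul_score h0 h1]
    simp
  have := measureReal_sum_gt_le_exp hξ hind (f := f) (by fun_prop) hmean hexp
    (x := δ / 4) (by linarith) (by linarith)
  refine le_trans (measureReal_mono ?_ (by finiteness)) this
  intro ω hω
  simp only [Set.mem_ofPred_eq, f, ← Finset.sum_div, abs_div] at hω ⊢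
  rw [abs_of_pos (by norm_num : (0 : ℝ) < 4)]
  linarith

lemma measureReal_envelope_ge_le (hD : IsModel D πp h μp μm S) (h0 : 0 < πp) (h1 : πp < 1)
    (hξ : ∀ i, HasLaw (ξ i) D P) (hind : iIndepFun ξ P) (j k : Fin p)
    {M K : ℝ} (hM : 0 ≤ M) (hμ : ∀ j, |μm j| ≤ M) (hK0 : 0 ≤ K) (hK : GaussianMomentBound M K)
    {b s η W δ : ℝ} (hn : 0 < n) (hb : 1 ≤ b) (hs : 0 ≤ s)
    (hsb : 8 * (1 + s) ≤ b ^ 2) (hsN : Real.log n = s * Real.log b) (hη : 0 ≤ η) (hW0 : 0 ≤ W)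
    (hW : ∀ m, |m| ≤ M →
      ∫⁻ t, ENNReal.ofReal (tailWeight η t) ∂(gaussianReal m 1) ≤ ENNReal.ofReal W) :
    P.real {ω | n * δ < ∑ i, envelope b (h j ((ξ i ω).2 j)) (h k ((ξ i ω).2 k)) ^ 2
        * tailWeight η (h j ((ξ i ω).2 j))}
      ≤ Real.exp (n * (3 * K / n + 3 * b * W) - n * δ / (6 * b ^ 2)) := by
  have := hD.isProbabilityMeasure
  have hn' : (0 : ℝ) < n := by exact_mod_cast hn
  have hmj := hD.aemeasurable_coord h0 h1 j
  have hmk := hD.aemeasurable_coord h0 h1 k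
  have hmw : AEMeasurable (fun z : ℤ × (Fin p → ℝ) => tailWeight η (h j (z.2 j))) D :=
    (measurable_tailWeight η).comp_aemeasurable hmj
  have hme : AEMeasurable (fun z : ℤ × (Fin p → ℝ) =>
      envelope b (h j (z.2 j)) (h k (z.2 k)) ^ 2 * tailWeight η (h j (z.2 j)) / (6 * b ^ 2)) D := by
    have hR : AEMeasurable (fun z : ℤ × (Fin p → ℝ) =>
        envelope b (h j (z.2 j)) (h k (z.2 k))) D := (hmj.norm.const_add b).add hmk.norm
    exact ((hR.pow_const 2).mul hmw).div_const _
  have hE : ∀ l, AEMeasurable (fun z : ℤ × (Fin p → ℝ) =>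
      ENNReal.ofReal (Real.exp (1 / 2 * (|h l (z.2 l)| + 1) ^ 2 / 2))) D := by
    intro l
    have hg : Measurable (fun t : ℝ => ENNReal.ofReal (Real.exp (1 / 2 * (|t| + 1) ^ 2 / 2))) := by
      fun_prop
    exact hg.comp_aemeasurable (hD.aemeasurable_coord h0 h1 l)
  have hb0 : 0 < b := by linarith
  have hC : (0 : ℝ) ≤ 3 / (2 * n) := by positivity
  have := measureReal_sum_ge_le_exp hξ hind hme (m := 3 * K / n + 3 * b * W) ?_
    (n * δ / (6 * b ^ 2))
  · refine le_trans (measureReal_mono ?_ (by finiteness)) this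
    intro ω hω
    simp only [Set.mem_ofPred_eq, ← Finset.sum_div] at hω ⊢
    gcongr
  · calc ∫⁻ z, ENNReal.ofReal (Real.exp (envelope b (h j (z.2 j)) (h k (z.2 k)) ^ 2
          * tailWeight η (h j (z.2 j)) / (6 * b ^ 2))) ∂D
        ≤ ∫⁻ z, (1 + (ENNReal.ofReal (3 / (2 * n))
              * ENNReal.ofReal (Real.exp (1 / 2 * (|h j (z.2 j)| + 1) ^ 2 / 2))
            + (ENNReal.ofReal (3 / (2 * n))
              * ENNReal.ofReal (Real.exp (1 / 2 * (|h k (z.2 k)| + 1) ^ 2 / 2))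
            + ENNReal.ofReal (3 * b) * ENNReal.ofReal (tailWeight η (h j (z.2 j)))))) ∂D := by
          refine lintegral_mono fun z => ?_
          have hw := tailWeight_nonneg hη (h j (z.2 j))
          rw [← ENNReal.ofReal_mul hC, ← ENNReal.ofReal_mul hC, ← ENNReal.ofReal_mul (by positivity),
            ← ENNReal.ofReal_add (by positivity) (by positivity),
            ← ENNReal.ofReal_add (by positivity) (by positivity), ← ENNReal.ofReal_one,
            ← ENNReal.ofReal_add (by positivity) (by positivity)]
          exact ENNReal.ofReal_le_ofReal
            (exp_envelope_mul_tailWeight_le hb hs hsb hn' hsN hη)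
      _ ≤ 1 + (ENNReal.ofReal (3 / (2 * n)) * ENNReal.ofReal K
            + (ENNReal.ofReal (3 / (2 * n)) * ENNReal.ofReal K
            + ENNReal.ofReal (3 * b) * ENNReal.ofReal W)) := by
          rw [lintegral_add_left' aemeasurable_const, lintegral_add_left' ((hE j).const_mul _),
            lintegral_add_left' ((hE k).const_mul _),
            lintegral_const_mul' _ _ ENNReal.ofReal_ne_top,
            lintegral_const_mul' _ _ ENNReal.ofReal_ne_top,
            lintegral_const_mul' _ _ ENNReal.ofReal_ne_top]
          have key := fun l => hD.lintegral_comp_coord_le h0 h1 hM hμ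
            (g := fun t => ENNReal.ofReal (Real.exp (1 / 2 * (|t| + 1) ^ 2 / 2))) (by fun_prop)
            hK l
          have keyw := hD.lintegral_comp_coord_le h0 h1 hM hμ
            (g := fun t => ENNReal.ofReal (tailWeight η t))
            (measurable_tailWeight η).ennreal_ofReal hW j
          gcongr
          · simp
          · exact key j
          · exact key k
      _ = ENNReal.ofReal (1 + (3 * K / n + 3 * b * W)) := by
          rw [← ENNReal.ofReal_mul hC, ← ENNReal.ofReal_mul (by positivity),
            ← ENNReal.ofReal_add (by positivity) (by positivity),
            ← ENNReal.ofReal_add (by positivity) (by positivity), ← ENNReal.ofReal_one,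
            ← ENNReal.ofReal_add (by positivity) (by positivity)]
          congr 1
          field_simp
          ring
      _ ≤ _ := ENNReal.ofReal_le_ofReal (by linarith [Real.add_one_le_exp (3 * K / n + 3 * b * W)])

end IsModel

lemma lintegral_tailWeight_le {M K a η : ℝ} (ha0 : 0 ≤ a) (ha1 : a ≤ 1) (hη : 0 ≤ η)
    (hK : ∀ m : ℝ, |m| ≤ M →
      ∫⁻ z, ENNReal.ofReal (Real.exp (a * (|z| + 1) ^ 2 / 2)) ∂(gaussianReal m 1)
        ≤ ENNReal.ofReal K) (m : ℝ) (hm : |m| ≤ M) :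
    ∫⁻ t, ENNReal.ofReal (tailWeight η t) ∂(gaussianReal m 1)
      ≤ ENNReal.ofReal ((3 * η) ^ a * K) := by
  have h : (0 : ℝ) ≤ (3 * η) ^ a := by positivity
  calc ∫⁻ t, ENNReal.ofReal (tailWeight η t) ∂(gaussianReal m 1)
      ≤ ∫⁻ t, ENNReal.ofReal ((3 * η) ^ a)
          * ENNReal.ofReal (Real.exp (a * (|t| + 1) ^ 2 / 2)) ∂(gaussianReal m 1) := by
        refine lintegral_mono fun t => ?_
        rw [← ENNReal.ofReal_mul h]
        exact ENNReal.ofReal_le_ofReal (tailWeight_le_rpow hη ha0 ha1 t)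
    _ ≤ _ := by
        rw [lintegral_const_mul' _ _ (by simp), ENNReal.ofReal_mul h]
        gcongr
        exact hK m hm

end Events

end SeLDA

namespace SeLDA

lemma one_le_envelope {b : ℝ} (hb : 1 ≤ b) (u v : ℝ) : 1 ≤ envelope b u v := by
  unfold envelope; linarith [abs_nonneg u, abs_nonneg v]

lemma envelope_comm (b u v : ℝ) : envelope b u v = envelope b v u := by
  unfold envelope; ring

section Deterministic

variable {n p : ℕ} {y : Fin n → ℤ} {x : Fin n → Fin p → ℝ}

lemma abs_hHat_sub_le_envelope {j : Fin p} {z : Fin n → ℝ}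
    (hz : ∀ i l, x l j ≤ x i j ↔ z l ≤ z i) {π π' τ η b : ℝ} (hn : 0 < n) (hπ0 : 0 < π')
    (hππ : π' ≤ π) (hπ1 : π ≤ 1) (hnπ : 4 ≤ n * π') (hτ : τ ≤ π' / 2)
    (hN : |(classSize y 1 : ℝ) / n - π| ≤ τ)
    {q : ℕ → ℝ} (hq : ∀ k, 0 < k → k < n → normalCdf (q k) = k / n)
    (hAq : ∀ k, 0 < k → k < n →
      |(∑ i, if y i = 1 ∧ z i ≤ q k then (1 : ℝ) else 0) / n - π * (k / n)| ≤ τ)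
    (hη0 : 0 < η) (hη : (4 * τ + 4 / n) / π + 4 / (π' * n) ^ 2 < η) (hb : 1 ≤ b)
    (hb0 : normalCdf (-b) < 1 / (n : ℝ) ^ 2) (hb1 : 1 - 1 / (n : ℝ) ^ 2 ≤ normalCdf b) (i : Fin n) :
    |hHat y x j (x i j) - z i| ≤ (b + |z i|) * tailWeight η (z i) := by
  have hn' : (0 : ℝ) < n := by exact_mod_cast hn
  have h1 : π' / 2 * n ≤ classSize y 1 := by
    rw [← le_div_iff₀ hn']; linarith [(abs_le.1 hN).1]
  have h2 : 2 ≤ classSize y 1 := by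
    have : (2 : ℝ) ≤ classSize y 1 := by linarith
    exact_mod_cast this
  refine abs_hHat_sub_le h2 hη0 ?_ hb hb0 hb1
  have h3 := abs_ecdf_sub_normalCdf_le hz hn (hπ0.trans_le hππ) hπ1 (by linarith) hN hq hAq i
  have h4 : 1 / (classSize y 1 : ℝ) ^ 2 ≤ 1 / (π' / 2 * n) ^ 2 := by gcongr
  have h5 : 1 / (π' / 2 * n) ^ 2 = 4 / (π' * n) ^ 2 := by field_simp; ring
  linarith

/-- The two estimation errors on the event that all the empirical averages are close to their
expectations. -/
lemma abs_errors_le {j k : Fin p} {z z' : Fin n → ℝ} {mp mm : Fin p → ℝ} {σ b δ π' : ℝ} {v v' : ℝ → ℝ}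
    (hn : 4 ≤ n) (hy : ∀ i, y i = 1 ∨ y i = -1) (hπ : 0 < π') (hσ : |σ| ≤ 1)
    (hN : ∀ s, s = 1 ∨ s = -1 → π' / 2 ≤ (classSize y s : ℝ) / n) (hb : 1 ≤ b)
    (hm : ∀ s l, |classMean mp mm s l| ≤ b)
    (he : ∀ i, |hHat y x j (x i j) - z i| ≤ (b + |z i|) * v (z i))
    (he' : ∀ i, |hHat y x k (x i k) - z' i| ≤ (b + |z' i|) * v' (z' i))
    (hv : ∀ t, 0 ≤ v t) (hv' : ∀ t, 0 ≤ v' t) (hv1 : ∀ t, v' t ≤ 1)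
    (hs : ∑ i, envelope b (z i) (z' i) ^ 2 * v (z i) ≤ n * δ)
    (hs' : ∑ i, envelope b (z' i) (z i) ^ 2 * v' (z' i) ≤ n * δ)
    (hz : ∀ s, s = 1 ∨ s = -1 →
      |∑ i, if y i = s then z i - classMean mp mm (y i) j else 0| ≤ n * δ)
    (hz' : ∀ s, s = 1 ∨ s = -1 →
      |∑ i, if y i = s then z' i - classMean mp mm (y i) k else 0| ≤ n * δ)
    (hzz : |∑ i, ((z i - classMean mp mm (y i) j) * (z' i - classMean mp mm (y i) k) - σ)| ≤ n * δ)
    (hδ : 4 * δ / π' ≤ 1) :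
    |(muHat y x 1 j - muHat y x (-1) j) - (mp j - mm j)| ≤ 8 * δ / π' ∧
      |sigmaHat y x j k - σ| ≤ 8 * δ + 8 * δ / π' + 4 / n := by
  have hn0 : 0 < n := by omega
  have hle : ∀ (u w : ℝ) {c : ℝ}, 0 ≤ c → (b + |u|) * c ≤ envelope b u w * c := by
    intro u w c hc
    refine mul_le_mul_of_nonneg_right ?_ hc
    unfold envelope
    linarith [abs_nonneg w]
  have hle2 : ∀ (u w : ℝ) {c : ℝ}, 0 ≤ c → (b + |u|) * c ≤ envelope b u w ^ 2 * c := by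
    intro u w c hc
    refine (hle u w hc).trans (mul_le_mul_of_nonneg_right ?_ hc)
    nlinarith [one_le_envelope hb u w]
  have hsum : ∀ (s : ℤ) (l : Fin p) (f : Fin n → ℝ),
      (∑ i, if y i = s then f i - classMean mp mm (y i) l else 0)
        = ∑ i, if y i = s then f i - classMean mp mm s l else 0 := by
    intro s l f
    refine Finset.sum_congr rfl fun i _ => ?_
    split_ifs with h
    · rw [h]
    · rfl
  have hdj : ∀ s, s = 1 ∨ s = -1 → |muHat y x s j - classMean mp mm s j| ≤ 4 * δ / π' := by
    intro s hsp
    refine abs_muHat_sub_le (z := z) (e := fun i => envelope b (z i) (z' i) ^ 2 * v (z i)) hn0 hπ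
      (hN s hsp) ?_ (fun i => (he i).trans (hle2 _ _ (hv _))) hs
    rw [← hsum]
    exact hz s hsp
  have hdk : ∀ s, s = 1 ∨ s = -1 → |muHat y x s k - classMean mp mm s k| ≤ 4 * δ / π' := by
    intro s hsp
    refine abs_muHat_sub_le (z := z') (e := fun i => envelope b (z' i) (z i) ^ 2 * v' (z' i)) hn0 hπ
      (hN s hsp) ?_ (fun i => (he' i).trans (hle2 _ _ (hv' _))) hs'
    rw [← hsum]
    exact hz' s hsp
  constructor
  · have h1 := hdj 1 (Or.inl rfl)
    have h2 := hdj (-1) (Or.inr rfl)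
    simp only [classMean, if_true, show ¬((-1 : ℤ) = 1) by norm_num, if_false] at h1 h2
    have h3 : 8 * δ / π' = 4 * δ / π' + 4 * δ / π' := by ring
    rw [h3]
    rw [abs_le] at h1 h2 ⊢
    constructor <;> linarith
  · have hwr : ∀ i, |z i - classMean mp mm (y i) j| ≤ envelope b (z i) (z' i) := by
      intro i
      refine (abs_sub _ _).trans ?_
      unfold envelope
      linarith [hm (y i) j, abs_nonneg (z' i)]
    have hwr' : ∀ i, |z' i - classMean mp mm (y i) k| ≤ envelope b (z i) (z' i) := by
      intro i
      refine (abs_sub _ _).trans ?_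
      unfold envelope
      linarith [hm (y i) k, abs_nonneg (z i)]
    have := abs_sigmaHat_sub_le (x := x) (z := z) (z' := z')
      (w := fun i => z i - classMean mp mm (y i) j) (w' := fun i => z' i - classMean mp mm (y i) k)
      (r := fun i => envelope b (z i) (z' i)) (v := fun i => v (z i)) (v' := fun i => v' (z' i))
      (m := fun s => classMean mp mm s j) (m' := fun s => classMean mp mm s k)
      hn hy hπ hσ hN (fun _ => rfl) (fun _ => rfl) hwr hwr'
      (fun i => (he i).trans (hle _ _ (hv _)))
      (fun i => (he' i).trans (by rw [envelope_comm]; exact hle _ _ (hv' _)))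
      (fun i => hv _) (fun i => hv1 _) hs (by simpa only [envelope_comm] using hs') hzz hδ hdj hdk
    refine this.trans (le_of_eq ?_)
    ring

end Deterministic

section Probability

variable {n p : ℕ} {D : Measure (ℤ × (Fin p → ℝ))} {πp : ℝ} {h : Fin p → ℝ → ℝ}
  {μp μm : EuclideanSpace ℝ (Fin p)} {S : Matrix (Fin p) (Fin p) ℝ}
  {Ω : Type*} [MeasurableSpace Ω] {P : Measure Ω}
  {ξ : Fin n → Ω → ℤ × (Fin p → ℝ)}

lemma ae_forall_of_hasLaw (hξ : ∀ i, HasLaw (ξ i) D P) {r : ℤ × (Fin p → ℝ) → Prop}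
    (hr : ∀ᵐ z ∂D, r z) : ∀ᵐ ω ∂P, ∀ i, r (ξ i ω) := by
  rw [ae_all_iff]
  intro i
  refine ae_of_ae_map (hξ i).aemeasurable ?_
  rwa [(hξ i).map_eq]

lemma IsModel.ae_order (hD : IsModel D πp h μp μm S) (hξ : ∀ i, HasLaw (ξ i) D P) (j : Fin p) :
    ∀ᵐ ω ∂P, ∀ i l, (ξ l ω).2 j ≤ (ξ i ω).2 j ↔ h j ((ξ l ω).2 j) ≤ h j ((ξ i ω).2 j) := by
  obtain ⟨s, hs, has⟩ := hD.strictMono j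
  filter_upwards [ae_forall_of_hasLaw hξ has] with ω hω i l
  exact (hs.le_iff_le (hω l) (hω i)).symm

lemma sum_sub_const_div {ι : Type*} [Fintype ι] (f : ι → ℝ) {c N : ℝ} (hN : N = Fintype.card ι)
    (hN0 : 0 < N) : (∑ i, f i) / N - c = (∑ i, (f i - c)) / N := by
  rw [Finset.sum_sub_distrib, Finset.sum_const, Finset.card_univ, nsmul_eq_mul, ← hN]
  field_simp

/-- Union bound for the two estimation errors. -/
lemma IsModel.measureReal_errors_le [IsProbabilityMeasure P] (hD : IsModel D πp h μp μm S) (h0 : 0 < πp) (h1 : πp < 1)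
    (hξ : ∀ i, HasLaw (ξ i) D P) (hind : iIndepFun ξ P)
    {M K : ℝ} (hM : 0 ≤ M) (hμ : ∀ j, |μm j| ≤ M) (hK0 : 0 < K) (hK : GaussianMomentBound M K)
    {b s η W δ τ β π' : ℝ} (hn : 4 ≤ n) (hb : 1 ≤ b) (hMb : M ≤ b) (hs : 0 ≤ s)
    (hsb : 8 * (1 + s) ≤ b ^ 2) (hsN : Real.log n = s * Real.log b) (hη : 0 < η) (hW0 : 0 ≤ W)
    (hW : ∀ m, |m| ≤ M →
      ∫⁻ t, ENNReal.ofReal (tailWeight η t) ∂(gaussianReal m 1) ≤ ENNReal.ofReal W)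
    (hπ : 0 < π') (hπp : π' ≤ πp) (hπm : π' ≤ 1 - πp) (hnπ : 4 ≤ n * π')
    (hτ0 : 0 < τ) (hτ1 : τ ≤ π' / 2) (hητ : (4 * τ + 4 / n) / πp + 4 / (π' * n) ^ 2 < η)
    (hb0 : normalCdf (-b) < 1 / (n : ℝ) ^ 2) (hb1 : 1 - 1 / (n : ℝ) ^ 2 ≤ normalCdf b)
    (hδ0 : 0 < δ) (hδ1 : 4 * δ / π' ≤ 1)
    (hβ1 : Real.exp (-(n * τ ^ 2 / 96)) ≤ β)
    (hβ2 : Real.exp (n * (3 * K / n + 3 * b * W) - n * δ / (6 * b ^ 2)) ≤ β)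
    (hβ3 : Real.exp (-(n * δ ^ 2 / (1536 * K))) ≤ β) (j k : Fin p) :
    P.real {ω | ¬ (|(muHat (fun i => (ξ i ω).1) (fun i => (ξ i ω).2) 1 j
          - muHat (fun i => (ξ i ω).1) (fun i => (ξ i ω).2) (-1) j) - (μp j - μm j)| ≤ 8 * δ / π' ∧
        |sigmaHat (fun i => (ξ i ω).1) (fun i => (ξ i ω).2) j k - S j k|
          ≤ 8 * δ + 8 * δ / π' + 4 / n)} ≤ (4 * n + 18) * β := by
  have hn0 : 0 < n := by omega
  have hn' : (0 : ℝ) < n := by exact_mod_cast hn0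
  have hπ1 : π' ≤ 1 := by linarith
  have hτ1' : τ ≤ 1 := by linarith
  have hδ1' : δ ≤ 1 := by
    rw [div_le_one hπ] at hδ1; linarith
  have hqex : ∀ l : ℕ, ∃ q : ℝ, 0 < l → l < n → normalCdf q = l / n := by
    intro l
    by_cases hl : 0 < l ∧ l < n
    · have hl0 : (0 : ℝ) < l := by exact_mod_cast hl.1
      obtain ⟨q, hq⟩ := exists_normalCdf_eq (u := (l : ℝ) / n) (by positivity)
        (by rw [div_lt_one hn']; exact_mod_cast hl.2)
      exact ⟨q, fun _ _ => hq⟩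
    · exact ⟨0, fun h1 h2 => absurd ⟨h1, h2⟩ hl⟩
  choose q hq using hqex
  set A1 : ℤ → Set Ω := fun s =>
    {ω | n * τ < |∑ i, ((if (ξ i ω).1 = s then (1 : ℝ) else 0) - D.real {z | z.1 = s})|} with hA1
  set A2 : Fin p → ℕ → Set Ω := fun l m =>
    {ω | n * τ < |∑ i, ((if (ξ i ω).1 = 1 ∧ h l ((ξ i ω).2 l) ≤ q m then (1 : ℝ) else 0)
        - πp * normalCdf (q m))|} with hA2
  set A3 : Fin p → Fin p → Set Ω := fun l m =>
    {ω | n * δ < ∑ i, envelope b (h l ((ξ i ω).2 l)) (h m ((ξ i ω).2 m)) ^ 2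
        * tailWeight η (h l ((ξ i ω).2 l))} with hA3
  set A4 : ℤ → Fin p → Set Ω := fun s l =>
    {ω | n * δ < |∑ i, (if (ξ i ω).1 = s then score h μp μm l (ξ i ω) else 0)|} with hA4
  set A5 : Set Ω :=
    {ω | n * δ < |∑ i, (score h μp μm j (ξ i ω) * score h μp μm k (ξ i ω) - S j k)|} with hA5
  have b1 : ∀ s, P.real (A1 s) ≤ 2 * β := fun s =>
    (hD.measureReal_classSize_gt_le hξ hind s hτ0 hτ1').trans (by linarith)
  have b2 : ∀ l m, P.real (A2 l m) ≤ 2 * β := fun l m =>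
    (hD.measureReal_count_gt_le h0 h1 hξ hind (q m) l hτ0 hτ1').trans (by linarith)
  have b2' : ∀ l, P.real (⋃ m ∈ Finset.range n, A2 l m) ≤ n * (2 * β) := by
    intro l
    refine (measureReal_biUnion_finset_le _ _).trans ?_
    refine (Finset.sum_le_sum fun m _ => b2 l m).trans (le_of_eq ?_)
    simp
  have hβ0 : 0 ≤ β := (Real.exp_pos _).le.trans hβ1
  have b3 : ∀ l m, P.real (A3 l m) ≤ 2 * β := fun l m =>
    (hD.measureReal_envelope_ge_le h0 h1 hξ hind l m hM hμ hK0.le hK hn0 hb hs hsb hsN hη.le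
      hW0 hW).trans (by linarith)
  have hβ4 : Real.exp (-(n * δ ^ 2 / (32 * (3 * K)))) ≤ β := by
    refine le_trans (Real.exp_le_exp.2 (neg_le_neg ?_)) hβ3
    rw [show (32 * (3 * K)) = 96 * K by ring]
    gcongr
    norm_num
  have b4 : ∀ s, s = 1 ∨ s = -1 → ∀ l, P.real (A4 s l) ≤ 2 * β := fun s hs l =>
    (hD.measureReal_score_gt_le h0 h1 hξ hind hs l hM hK hδ0 hδ1').trans (by linarith)
  have b5 : P.real A5 ≤ 2 * β := by
    refine (hD.measureReal_score_mul_gt_le h0 h1 hξ hind j k hM hK hδ0 hδ1').trans ?_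
    have : n * (δ / 4) ^ 2 / (32 * (3 * K)) = n * δ ^ 2 / (1536 * K) := by field_simp; ring
    rw [this]
    linarith
  set U : Set Ω := (A1 1 ∪ A1 (-1)) ∪ ((⋃ m ∈ Finset.range n, A2 j m) ∪ (⋃ m ∈ Finset.range n, A2 k m))
    ∪ (A3 j k ∪ A3 k j) ∪ ((A4 1 j ∪ A4 (-1) j) ∪ (A4 1 k ∪ A4 (-1) k)) ∪ A5 with hU
  have hUβ : P.real U ≤ (4 * n + 18) * β := by
    have u1 := measureReal_union_le (μ := P) (A1 1) (A1 (-1))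
    have u2 := measureReal_union_le (μ := P) (⋃ m ∈ Finset.range n, A2 j m)
      (⋃ m ∈ Finset.range n, A2 k m)
    have u3 := measureReal_union_le (μ := P) (A3 j k) (A3 k j)
    have u4 := measureReal_union_le (μ := P) (A4 1 j) (A4 (-1) j)
    have u5 := measureReal_union_le (μ := P) (A4 1 k) (A4 (-1) k)
    have u6 := measureReal_union_le (μ := P) (A4 1 j ∪ A4 (-1) j) (A4 1 k ∪ A4 (-1) k)
    have u7 := measureReal_union_le (μ := P) (A1 1 ∪ A1 (-1))
      ((⋃ m ∈ Finset.range n, A2 j m) ∪ (⋃ m ∈ Finset.range n, A2 k m))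
    have u8 := measureReal_union_le (μ := P) ((A1 1 ∪ A1 (-1)) ∪
      ((⋃ m ∈ Finset.range n, A2 j m) ∪ (⋃ m ∈ Finset.range n, A2 k m))) (A3 j k ∪ A3 k j)
    have u9 := measureReal_union_le (μ := P) ((A1 1 ∪ A1 (-1)) ∪
      ((⋃ m ∈ Finset.range n, A2 j m) ∪ (⋃ m ∈ Finset.range n, A2 k m)) ∪ (A3 j k ∪ A3 k j))
      ((A4 1 j ∪ A4 (-1) j) ∪ (A4 1 k ∪ A4 (-1) k))
    have u10 := measureReal_union_le (μ := P) ((A1 1 ∪ A1 (-1)) ∪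
      ((⋃ m ∈ Finset.range n, A2 j m) ∪ (⋃ m ∈ Finset.range n, A2 k m)) ∪ (A3 j k ∪ A3 k j) ∪
      ((A4 1 j ∪ A4 (-1) j) ∪ (A4 1 k ∪ A4 (-1) k))) A5
    linarith [b1 1, b1 (-1), b2' j, b2' k, b3 j k, b3 k j, b4 1 (Or.inl rfl) j,
      b4 (-1) (Or.inr rfl) j, b4 1 (Or.inl rfl) k, b4 (-1) (Or.inr rfl) k, b5]
  refine le_trans (ENNReal.toReal_mono (measure_ne_top P U) (measure_mono_ae ?_)) hUβ
  filter_upwards [ae_forall_of_hasLaw hξ hD.ae_label, hD.ae_order hξ j, hD.ae_order hξ k]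
    with ω hy hoj hok hbad
  change ω ∈ U
  by_contra hωU
  refine hbad ?_
  simp only [hU, Set.mem_union, not_or, Set.mem_iUnion, not_exists, Finset.mem_range] at hωU
  obtain ⟨⟨⟨⟨⟨g11, g12⟩, g2j, g2k⟩, g31, g32⟩, ⟨g41, g42⟩, g43, g44⟩, g5⟩ := hωU
  simp only [hA1, hA2, hA3, hA4, hA5, Set.mem_ofPred_eq, not_lt] at g11 g12 g2j g2k g31 g32 g41 g42 g43 g44 g5
  rw [hD.prob_pos] at g11
  rw [hD.prob_neg] at g12
  have hcard : (n : ℝ) = Fintype.card (Fin n) := by simp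
  have c1 : |(classSize (fun i => (ξ i ω).1) 1 : ℝ) / n - πp| ≤ τ := by
    rw [classSize_eq_sum, sum_sub_const_div _ hcard hn', abs_div, abs_of_pos hn', div_le_iff₀ hn']
    linarith
  have c2 : |(classSize (fun i => (ξ i ω).1) (-1) : ℝ) / n - (1 - πp)| ≤ τ := by
    rw [classSize_eq_sum, sum_sub_const_div _ hcard hn', abs_div, abs_of_pos hn', div_le_iff₀ hn']
    linarith
  have grid : ∀ l, (∀ m, m < n → |∑ i, ((if (ξ i ω).1 = 1 ∧ h l ((ξ i ω).2 l) ≤ q m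
        then (1 : ℝ) else 0) - πp * normalCdf (q m))| ≤ n * τ) → ∀ m, 0 < m → m < n →
      |(∑ i, if (ξ i ω).1 = 1 ∧ h l ((ξ i ω).2 l) ≤ q m then (1 : ℝ) else 0) / n
        - πp * (m / n)| ≤ τ := by
    intro l hl m hm0 hmn
    have := hl m hmn
    rw [hq m hm0 hmn] at this
    rw [sum_sub_const_div _ hcard hn', abs_div, abs_of_pos hn', div_le_iff₀ hn']
    linarith
  have ej := abs_hHat_sub_le_envelope (y := fun i => (ξ i ω).1) (x := fun i => (ξ i ω).2)
    (z := fun i => h j ((ξ i ω).2 j)) hoj hn0 hπ hπp h1.le hnπ hτ1 c1 (q := q) hq (grid j g2j) hη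
    hητ hb hb0 hb1
  have ek := abs_hHat_sub_le_envelope (y := fun i => (ξ i ω).1) (x := fun i => (ξ i ω).2)
    (z := fun i => h k ((ξ i ω).2 k)) hok hn0 hπ hπp h1.le hnπ hτ1 c1 (q := q) hq (grid k g2k) hη
    hητ hb hb0 hb1
  refine abs_errors_le (y := fun i => (ξ i ω).1) (x := fun i => (ξ i ω).2)
    (z := fun i => h j ((ξ i ω).2 j)) (z' := fun i => h k ((ξ i ω).2 k))
    (v := tailWeight η) (v' := tailWeight η) (mp := μp) (mm := μm) (b := b)
    hn hy hπ (hD.abs_cov_le_one j k) ?_ hb ?_ ej ek (tailWeight_nonneg hη.le)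
    (tailWeight_nonneg hη.le) (tailWeight_le_one η) g31 g32 ?_ ?_ g5 hδ1
  · rintro s (rfl | rfl)
    · linarith [(abs_le.1 c1).1]
    · linarith [(abs_le.1 c2).1]
  · intro s l
    unfold classMean
    split_ifs
    · rw [hD.mean_pos]; simp; linarith
    · exact (hμ l).trans hMb
  · rintro s (rfl | rfl)
    · exact g41
    · exact g42
  · rintro s (rfl | rfl)
    · exact g43
    · exact g44

end Probability

end SeLDA

namespace SeLDA

lemma eventually_rpow_dominates {κ : ℝ} (hκ : 0 < κ) (B : ℝ) :
    ∃ N₀ : ℕ, 0 < N₀ ∧ ∀ n : ℕ, N₀ ≤ n → B ≤ (n : ℝ) ^ κ ∧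
      4 * (n : ℝ) + 18 ≤ Real.exp ((n : ℝ) ^ κ - 1) ∧
      B * Real.exp (-(((n : ℝ) ^ κ) ^ 2 / 4)) < 1 / (n : ℝ) ^ 2 := by
  have h1 : ∀ᶠ n : ℕ in Filter.atTop, max B 26 ≤ (n : ℝ) ^ κ :=
    ((tendsto_rpow_atTop hκ).comp tendsto_natCast_atTop_atTop).eventually_ge_atTop _
  have h2 : ∀ᶠ n : ℕ in Filter.atTop, ‖Real.log (n : ℝ)‖ ≤ 1 / 8 * ‖(n : ℝ) ^ κ‖ :=
    tendsto_natCast_atTop_atTop.eventually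
      ((isLittleO_log_rpow_atTop hκ).def (by norm_num : (0 : ℝ) < 1 / 8))
  obtain ⟨N₀, hN₀⟩ := Filter.eventually_atTop.1 (h1.and h2)
  refine ⟨max N₀ 1, by positivity, fun n hn => ?_⟩
  obtain ⟨e1, e2⟩ := hN₀ n ((le_max_left _ _).trans hn)
  have hn1 : (1 : ℝ) ≤ n := by exact_mod_cast (le_max_right _ _).trans hn
  have hn0 : (0 : ℝ) < n := by linarith
  set b := (n : ℝ) ^ κ
  have hB : B ≤ b := (le_max_left _ _).trans e1
  have hb : 26 ≤ b := (le_max_right _ _).trans e1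
  rw [Real.norm_of_nonneg (Real.log_nonneg hn1), Real.norm_of_nonneg (by linarith)] at e2
  have hnb : (n : ℝ) ≤ Real.exp (b / 8) := by
    rw [← Real.exp_log hn0]; exact Real.exp_le_exp.2 (by linarith)
  refine ⟨hB, ?_, ?_⟩
  · calc 4 * (n : ℝ) + 18 ≤ 22 * n := by linarith
      _ ≤ Real.exp 21 * Real.exp (b / 8) := by
          gcongr
          linarith [Real.add_one_le_exp (21 : ℝ)]
      _ = Real.exp (21 + b / 8) := (Real.exp_add _ _).symm
      _ ≤ _ := Real.exp_le_exp.2 (by linarith)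
  · rw [lt_div_iff₀ (by positivity)]
    calc B * Real.exp (-(b ^ 2 / 4)) * (n : ℝ) ^ 2
        ≤ Real.exp b * Real.exp (-(b ^ 2 / 4)) * Real.exp (b / 8) ^ 2 := by
          gcongr
          linarith [Real.add_one_le_exp b]
      _ = Real.exp (b + -(b ^ 2 / 4) + (2 : ℕ) * (b / 8)) := by
          rw [Real.exp_add, Real.exp_add, Real.exp_nat_mul]
      _ < 1 := by
          rw [Real.exp_lt_one_iff]
          push_cast
          nlinarith

lemma rpow_one_sub_le {x κ N : ℝ} (hN : 0 < N) (hκ : 0 ≤ κ) (hx : 1 / N ≤ x) :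
    x ^ (1 - κ) ≤ x * N ^ κ := by
  have hx0 : 0 < x := lt_of_lt_of_le (by positivity) hx
  rw [Real.rpow_sub hx0, Real.rpow_one, div_eq_mul_inv]
  refine mul_le_mul_of_nonneg_left ?_ hx0.le
  rw [← Real.inv_rpow hx0.le]
  refine Real.rpow_le_rpow (by positivity) ?_ hκ
  rw [inv_le_comm₀ hx0 hN, inv_eq_one_div]
  exact hx

/-- Exponential concentration of the two estimation errors. -/
theorem exists_measureReal_errors_le {πp : ℝ} (h0 : 0 < πp) (h1 : πp < 1) {M : ℝ} (hM : 0 ≤ M)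
    {θ : ℝ} (hθ0 : 0 < θ) (hθ1 : θ ≤ 1) :
    ∃ N₀ : ℕ, 0 < N₀ ∧ ∀ (n p : ℕ) (D : Measure (ℤ × (Fin p → ℝ))) (h : Fin p → ℝ → ℝ)
        (μp μm : EuclideanSpace ℝ (Fin p)) (S : Matrix (Fin p) (Fin p) ℝ),
        IsModel D πp h μp μm S → (∀ j, |μm j| ≤ M) →
      ∀ (Ω : Type*) [MeasurableSpace Ω] (P : Measure Ω) [IsProbabilityMeasure P]
        (ξ : Fin n → Ω → ℤ × (Fin p → ℝ)), (∀ i, HasLaw (ξ i) D P) → iIndepFun ξ P →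
      ∀ ε : ℝ, 0 < ε → ε < 1 → N₀ ≤ n → (n : ℝ) ^ θ ≤ n * ε ^ 2 → ∀ j k : Fin p,
        P.real {ω | ¬ (|(muHat (fun i => (ξ i ω).1) (fun i => (ξ i ω).2) 1 j
          - muHat (fun i => (ξ i ω).1) (fun i => (ξ i ω).2) (-1) j) - (μp j - μm j)| ≤ ε ∧
          |sigmaHat (fun i => (ξ i ω).1) (fun i => (ξ i ω).2) j k - S j k| ≤ ε)}
        ≤ Real.exp (-((n : ℝ) ^ (1 - θ) * ε ^ 2)) := by
  set π' := min πp (1 - πp) with hπ'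
  have hπ : 0 < π' := lt_min h0 (by linarith)
  have hπp : π' ≤ πp := min_le_left _ _
  have hπm : π' ≤ 1 - πp := min_le_right _ _
  have hπ1 : π' ≤ 1 := by linarith
  set κ := θ / 32 with hκdef
  have hκ : 0 < κ := by positivity
  have hκ1 : κ ≤ 1 / 32 := by rw [hκdef]; linarith
  obtain ⟨K, hK1, hK⟩ := exists_lintegral_exp_sq_gaussianReal_le (a := 1 / 2) (by norm_num)
    (by norm_num) M
  obtain ⟨Ka, hKa1, hKa⟩ := exists_lintegral_exp_sq_gaussianReal_le (a := 1 - κ) (by linarith)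
    (by linarith) M
  obtain ⟨Kt, hKt1, hKt⟩ := exists_gaussian_tail_le
  set c₀ := π' / 32 with hc₀
  have hc₀0 : 0 < c₀ := by positivity
  set s := 1 / κ with hs
  have hs0 : 0 ≤ s := by positivity
  set B := 96 + 4 / π' + M + 8 * (1 + s) + (8 / π' + 4 / π' ^ 2) + 1536 * K / c₀ ^ 2
    + 6 * (9 * Ka + 3 * K + 1) / c₀ + Kt with hB
  have hK0 : 0 < K := by linarith
  have p1 : 0 < 4 / π' := by positivity
  have p2 : 0 ≤ 8 * (1 + s) := by positivity
  have p3 : 0 < 8 / π' + 4 / π' ^ 2 := by positivity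
  have p4 : 0 < 1536 * K / c₀ ^ 2 := by positivity
  have p5 : 0 < 6 * (9 * Ka + 3 * K + 1) / c₀ := by positivity
  obtain ⟨N₀, hN₀, hN⟩ := eventually_rpow_dominates hκ B
  refine ⟨N₀, hN₀, ?_⟩
  intro n p D h μp μm S hD hμ Ω _ P _ ξ hξ hind ε hε0 hε1 hn hnε j k
  obtain ⟨g1, g2, g3⟩ := hN n hn
  have hn0 : 0 < n := by omega
  have hN0 : (0 : ℝ) < n := by exact_mod_cast hn0
  have hN1 : (1 : ℝ) ≤ n := by exact_mod_cast hn0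
  set N : ℝ := (n : ℝ) with hNdef
  set b := N ^ κ with hb
  have hb96 : 96 ≤ b := by linarith
  have hb0 : 0 < b := by linarith
  have hb1 : 1 ≤ b := by linarith
  have hbθ : b ^ 32 = N ^ θ := by
    rw [hb, ← Real.rpow_natCast, ← Real.rpow_mul hN0.le, hκdef]
    congr 1
    push_cast
    ring
  have hbN : b ^ 32 ≤ N := by
    rw [hbθ]
    calc N ^ θ ≤ N ^ (1 : ℝ) := Real.rpow_le_rpow_of_exponent_le hN1 hθ1
      _ = N := Real.rpow_one N
  have hbe : ∀ m : ℕ, 1 ≤ m → b ≤ b ^ m := fun m hm => le_self_pow₀ hb1 (by omega)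
  have hbbN : b ≤ N := (hbe 32 (by norm_num)).trans hbN
  rw [← hbθ] at hnε
  have hεε : ε ^ 2 ≤ ε := pow_le_of_le_one hε0.le hε1.le two_ne_zero
  have hNε : b ^ 32 ≤ N * ε := hnε.trans (by gcongr)
  have hNinv : ∀ m : ℕ, m ≤ 32 → 1 / N ≤ ε / b ^ m := by
    intro m hm
    rw [div_le_div_iff₀ hN0 (by positivity)]
    have : b ^ m ≤ b ^ 32 := pow_le_pow_right₀ hb1 hm
    linarith
  set t := N * ε ^ 2 / b ^ 32 with ht
  have ht1 : 1 ≤ t := by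
    rw [ht, one_le_div (by positivity)]; exact hnε
  have hexp : N ^ (1 - θ) * ε ^ 2 = t := by
    rw [Real.rpow_sub hN0, Real.rpow_one, ← hbθ, ht]; ring
  rw [hexp]
  set τ := ε / b ^ 8 with hτ
  set η := ε / b ^ 7 with hη
  set δ := c₀ * ε with hδ
  set W := 3 * Ka * ε / b ^ 6 with hW
  have hη0 : 0 < η := by positivity
  have hτ0 : 0 < τ := by positivity
  have hδ0 : 0 < δ := by positivity
  have hW0 : 0 ≤ W := by positivity
  have hWint : ∀ m, |m| ≤ M →
      ∫⁻ t, ENNReal.ofReal (tailWeight η t) ∂(gaussianReal m 1) ≤ ENNReal.ofReal W := by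
    intro m hm
    refine (lintegral_tailWeight_le (by linarith) (by linarith) hη0.le hKa m hm).trans
      (ENNReal.ofReal_le_ofReal ?_)
    have e1 : 1 / N ≤ 3 * η := (hNinv 7 (by norm_num)).trans (by rw [← hη]; linarith)
    have e2 := rpow_one_sub_le hN0 hκ.le e1
    rw [← hb] at e2
    calc (3 * η) ^ (1 - κ) * Ka ≤ 3 * η * b * Ka := by gcongr
      _ = W := by rw [hη, hW]; field_simp
  have hbig : 4 / π' ≤ b := by linarith
  have hnπ : 4 ≤ N * π' := by
    rw [div_le_iff₀ hπ] at hbig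
    exact hbig.trans (mul_le_mul_of_nonneg_right hbbN hπ.le)
  have hn4 : 4 ≤ n := by
    have : (4 : ℝ) ≤ n := by linarith
    exact_mod_cast this
  have hτ1 : τ ≤ π' / 2 := by
    rw [div_le_iff₀ hπ] at hbig
    rw [hτ, div_le_iff₀ (by positivity)]
    have := mul_le_mul_of_nonneg_right (hbe 8 (by norm_num)) hπ.le
    linarith
  have hητ : (4 * τ + 4 / N) / πp + 4 / (π' * N) ^ 2 < η := by
    have e1 : 1 / N ≤ τ := hNinv 8 (by norm_num)
    have e2 : 4 / N = 4 * (1 / N) := by ring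
    have e3 : (4 * τ + 4 / N) / πp ≤ 8 / π' * τ := by
      calc (4 * τ + 4 / N) / πp ≤ 8 * τ / π' := by
            apply div_le_div₀ (by positivity) _ hπ hπp
            linarith
        _ = _ := by ring
    have e4 : 4 / (π' * N) ^ 2 ≤ 4 / π' ^ 2 * τ := by
      have : 4 / (π' * N) ^ 2 = 4 / π' ^ 2 * ((1 / N) * (1 / N)) := by field_simp
      rw [this]
      have e5 : 1 / N ≤ 1 := by rw [div_le_one hN0]; exact hN1
      have : 1 / N * (1 / N) ≤ τ * 1 := mul_le_mul e1 e5 (by positivity) hτ0.le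
      rw [mul_one] at this
      gcongr
    have e6 : η = b * τ := by rw [hη, hτ]; field_simp
    have e7 : 8 / π' + 4 / π' ^ 2 < b := by linarith
    have e8 := mul_lt_mul_of_pos_right e7 hτ0
    rw [e6]
    linarith
  have htail := hKt b hb0.le
  have hKtB : Kt * Real.exp (-(b ^ 2 / 4)) ≤ B * Real.exp (-(b ^ 2 / 4)) := by
    gcongr
    linarith
  have hδπ : 4 * δ / π' = ε / 8 := by rw [hδ, hc₀]; field_simp; norm_num
  have hδπ' : 8 * δ / π' = ε / 4 := by rw [hδ, hc₀]; field_simp; norm_num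
  have hsN : Real.log N = s * Real.log b := by
    rw [hb, Real.log_rpow hN0, hs]; field_simp
  have hbsq : b ≤ b ^ 2 := hbe 2 (by norm_num)
  have htb : t * b = N * ε ^ 2 / b ^ 31 := by rw [ht]; field_simp
  have key := hD.measureReal_errors_le h0 h1 hξ hind hM hμ hK0 hK (b := b) (s := s) (η := η)
    (W := W) (δ := δ) (τ := τ) (β := Real.exp (-(t * b))) (π' := π') hn4 hb1 (by linarith) hs0
    (by linarith) hsN hη0 hW0 hWint hπ hπp hπm hnπ hτ0 hτ1 hητ (by linarith) (by linarith)
    hδ0 (by linarith) ?_ ?_ ?_ j k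
  · have h4n : 4 / N ≤ ε / 4 := by
      have e1 := hNinv 1 (by norm_num)
      have e2 : ε / b ^ 1 ≤ ε / 16 := by
        rw [pow_one]; gcongr; linarith
      have e3 : 4 / N = 4 * (1 / N) := by ring
      linarith
    have h8δ : 8 * δ ≤ ε / 4 := by
      have := mul_le_mul_of_nonneg_right hπ1 hε0.le
      rw [hδ, hc₀]
      linarith
    refine le_trans (measureReal_mono ?_ (by finiteness)) (key.trans ?_)
    · intro ω hω hgood
      exact hω ⟨hgood.1.trans (by linarith), hgood.2.trans (by linarith)⟩
    · calc (4 * N + 18) * Real.exp (-(t * b)) ≤ Real.exp (b - 1) * Real.exp (-(t * b)) := by gcongr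
        _ = Real.exp (b - 1 + -(t * b)) := (Real.exp_add _ _).symm
        _ ≤ _ := by
          have := mul_nonneg (sub_nonneg.2 ht1) (sub_nonneg.2 hb1)
          exact Real.exp_le_exp.2 (by linarith)
  · refine Real.exp_le_exp.2 (neg_le_neg ?_)
    rw [htb, hτ]
    have e1 : N * (ε / b ^ 8) ^ 2 / 96 = N * ε ^ 2 / (b ^ 16 * 96) := by field_simp
    rw [e1]
    apply div_le_div_of_nonneg_left (by positivity) (by positivity)
    calc b ^ 16 * 96 ≤ b ^ 16 * b ^ 15 := by
          gcongr; exact hb96.trans (hbe 15 (by norm_num))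
      _ = b ^ 31 := by ring
  · refine Real.exp_le_exp.2 ?_
    set r := N * ε / b ^ 5 with hr
    have hr0 : 0 < r := by positivity
    have e1 : 1 ≤ r := by
      rw [hr, one_le_div (by positivity)]
      exact (pow_le_pow_right₀ hb1 (by norm_num)).trans hNε
    have e2 : N * (3 * K / N + 3 * b * W) = 3 * K + 9 * Ka * r := by
      rw [hW, hr]; field_simp; ring
    have e3 : t * b ≤ r := by
      rw [htb, hr]
      apply div_le_div₀ (by positivity) (by gcongr) (by positivity)
        (pow_le_pow_right₀ hb1 (by norm_num))
    have e4 : N * δ / (6 * b ^ 2) = c₀ / 6 * b ^ 3 * r := by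
      rw [hδ, hr]; field_simp
    have e5 : 9 * Ka + 3 * K + 1 ≤ c₀ / 6 * b ^ 3 := by
      have e6 : 6 * (9 * Ka + 3 * K + 1) / c₀ ≤ b ^ 3 := by
        have := hbe 3 (by norm_num)
        linarith
      rw [div_le_iff₀ hc₀0] at e6
      linarith
    have e7 := mul_le_mul_of_nonneg_right e5 hr0.le
    have e8 := mul_le_mul_of_nonneg_left e1 (by positivity : 0 ≤ 3 * K)
    rw [e2, e4]
    linarith
  · refine Real.exp_le_exp.2 (neg_le_neg ?_)
    rw [htb, hδ]
    have e1 : N * (c₀ * ε) ^ 2 / (1536 * K) = N * ε ^ 2 / (1536 * K / c₀ ^ 2) := by field_simp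
    rw [e1]
    apply div_le_div_of_nonneg_left (by positivity) (by positivity)
    have := hbe 31 (by norm_num)
    linarith

lemma zetaStar₁_nonneg (c : ℝ) (n : ℕ) (ρ ε : ℝ) : 0 ≤ zetaStar₁ c n ρ ε := by
  unfold zetaStar₁; positivity

lemma zetaStar₂_nonneg {c C : ℝ} (hC : 0 ≤ C) (n : ℕ) (ρ ε : ℝ) : 0 ≤ zetaStar₂ c C n ρ ε := by
  unfold zetaStar₂; positivity

lemma zetaStar₁_le_zeta₁ (c πp : ℝ) (n : ℕ) (ρ ε : ℝ) :
    zetaStar₁ c n ρ (πp ^ (1 / 2 : ℝ) * ε / 2) ≤ zeta₁ c πp n ρ ε := by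
  unfold zeta₁
  have := zetaStar₁_nonneg c n ρ ((1 - πp) ^ (1 / 2 : ℝ) * ε / 2)
  have := Real.exp_pos (-c * n)
  linarith

lemma zeta₁_le_zeta₂ {c C : ℝ} (hC : 0 ≤ C) (πp : ℝ) (n : ℕ) (ρ ε : ℝ) :
    zeta₁ c πp n ρ ε ≤ zeta₂ c C πp n ρ ε := by
  have h1 := (zetaStar₁_nonneg c n ρ _).trans (zetaStar₁_le_zeta₁ c πp n ρ ε)
  unfold zeta₂
  have := zetaStar₂_nonneg (c := c) hC n ρ ((1 - πp) ^ (1 / 2 : ℝ) * ε / 2)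
  have := zetaStar₂_nonneg (c := c) hC n ρ (πp ^ (1 / 2 : ℝ) * ε / 2)
  have := Real.exp_pos (-c * n)
  linarith

lemma exp_le_zeta₁ {πp : ℝ} (h0 : 0 < πp) (n : ℕ) (ρ ε : ℝ) :
    2 * Real.exp (-(πp / 4 * (n * ε ^ 2))) ≤ zeta₁ 1 πp n ρ ε ∧
      4 * Real.exp (-(πp / 4 * ((n : ℝ) ^ (1 - 2 * ρ) * ε ^ 2 / ρ))) ≤ zeta₁ 1 πp n ρ ε := by
  have hz := zetaStar₁_le_zeta₁ 1 πp n ρ ε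
  have hsq : (πp ^ (1 / 2 : ℝ) * ε / 2) ^ 2 = πp / 4 * ε ^ 2 := by
    rw [← Real.sqrt_eq_rpow, div_pow, mul_pow, Real.sq_sqrt h0.le]; ring
  unfold zetaStar₁ at hz
  rw [hsq] at hz
  have e1 : -1 * (n : ℝ) * (πp / 4 * ε ^ 2) = -(πp / 4 * (n * ε ^ 2)) := by ring
  have e2 : -1 * (n : ℝ) ^ (1 - 2 * ρ) * (πp / 4 * ε ^ 2) / ρ
      = -(πp / 4 * ((n : ℝ) ^ (1 - 2 * ρ) * ε ^ 2 / ρ)) := by ring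
  rw [e1, e2] at hz
  have q1 := Real.exp_pos (-(πp / 4 * (n * ε ^ 2)))
  have q2 := Real.exp_pos (-(πp / 4 * ((n : ℝ) ^ (1 - 2 * ρ) * ε ^ 2 / ρ)))
  have q3 := Real.exp_pos (-1 * (n : ℝ) ^ (1 / 2 - ρ))
  constructor <;> linarith

end SeLDA

theorem corollary1 (πp : ℝ) (hπ0 : 0 < πp) (hπ1 : πp < 1) (M : ℝ) :
    ∃ c > 0, ∃ C > 0, ∀ ρ : ℝ, 0 < ρ → ρ < 1 / 3 → ∃ ε₀ > 0,
      ∀ (n p : ℕ) (D : Measure (ℤ × (Fin p → ℝ))) (h : Fin p → ℝ → ℝ)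
        (μp μm : EuclideanSpace ℝ (Fin p)) (S : Matrix (Fin p) (Fin p) ℝ),
        SeLDA.IsModel D πp h μp μm S → (∀ j, |μm j| ≤ M) →
      ∀ (Ω : Type*) [MeasurableSpace Ω] (P : Measure Ω) [IsProbabilityMeasure P]
        (Y : Fin n → Ω → ℤ) (X : Fin n → Ω → Fin p → ℝ),
        (∀ i, HasLaw (fun ω => (Y i ω, X i ω)) D P) →
        iIndepFun (fun i ω => (Y i ω, X i ω)) P →
      ∀ ε : ℝ, 0 < ε → ε < ε₀ →
        (∀ j : Fin p,
          P.real {ω | ε < |(SeLDA.muHat (fun i => Y i ω) (fun i => X i ω) 1 j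
              - SeLDA.muHat (fun i => Y i ω) (fun i => X i ω) (-1) j) - (μp j - μm j)|}
            ≤ SeLDA.zeta₁ c πp n ρ ε) ∧
        (∀ j k : Fin p,
          P.real {ω | ε < |SeLDA.sigmaHat (fun i => Y i ω) (fun i => X i ω) j k - S j k|}
            ≤ SeLDA.zeta₂ c C πp n ρ ε) := by
  refine ⟨1, one_pos, 1, one_pos, fun ρ hρ0 hρ1 => ?_⟩
  obtain ⟨N₀, hN₀, hcore⟩ := SeLDA.exists_measureReal_errors_le hπ0 hπ1 (abs_nonneg M) hρ0
    (by linarith : ρ ≤ 1)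
  obtain ⟨N₁, hN₁, hlarge⟩ := SeLDA.eventually_rpow_dominates hρ0 (1 / ρ)
  set N₂ := max N₀ N₁ with hN₂
  refine ⟨1 / (N₂ + 1), by positivity, ?_⟩
  intro n p D h μp μm S hD hμ Ω _ P _ Y X hlaw hind ε hε0 hε
  obtain ⟨hz1, hz2⟩ := SeLDA.exp_le_zeta₁ hπ0 n ρ ε
  have hz12 := SeLDA.zeta₁_le_zeta₂ (c := 1) (C := 1) zero_le_one πp n ρ ε
  have hquarter : ∀ x : ℝ, x ≤ 1 → 3 / 4 ≤ Real.exp (-(πp / 4 * x)) := by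
    intro x hx
    have := Real.add_one_le_exp (-(πp / 4 * x))
    nlinarith
  rw [lt_div_iff₀ (by positivity)] at hε
  have hN₂0 : (0 : ℝ) ≤ N₂ := by positivity
  have hε1 : ε < 1 := by nlinarith
  suffices hmain : 1 ≤ SeLDA.zeta₁ 1 πp n ρ ε ∨ ∀ j k : Fin p,
      P.real {ω | ¬ (|(SeLDA.muHat (fun i => Y i ω) (fun i => X i ω) 1 j
          - SeLDA.muHat (fun i => Y i ω) (fun i => X i ω) (-1) j) - (μp j - μm j)| ≤ ε ∧
          |SeLDA.sigmaHat (fun i => Y i ω) (fun i => X i ω) j k - S j k| ≤ ε)}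
        ≤ SeLDA.zeta₁ 1 πp n ρ ε by
    rcases hmain with hone | hbound
    · exact ⟨fun j => measureReal_le_one.trans hone,
        fun j k => measureReal_le_one.trans (hone.trans hz12)⟩
    · refine ⟨fun j => le_trans (measureReal_mono ?_ (by finiteness)) (hbound j j),
        fun j k => le_trans (measureReal_mono ?_ (by finiteness)) ((hbound j k).trans hz12)⟩
      · exact fun ω hω hgood => absurd hgood.1 (not_le.2 hω)
      · exact fun ω hω hgood => absurd hgood.2 (not_le.2 hω)
  by_cases hn : n < N₂
  · left
    have hn' : (n : ℝ) ≤ N₂ := by exact_mod_cast hn.le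
    have : (n : ℝ) * ε ^ 2 ≤ 1 := by nlinarith
    linarith [hquarter _ this]
  rw [not_lt] at hn
  have hn0 : (0 : ℝ) < n := by exact_mod_cast (hN₀.trans_le ((le_max_left _ _).trans hn))
  set E := (n : ℝ) ^ (1 - 2 * ρ) * ε ^ 2 / ρ with hE
  by_cases hE1 : E ≤ 1
  · left
    linarith [hquarter _ hE1]
  right
  rw [not_le] at hE1
  have hρn : 1 ≤ ρ * (n : ℝ) ^ ρ := by
    have := (hlarge n ((le_max_right _ _).trans hn)).1
    rw [div_le_iff₀ hρ0] at this
    linarith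
  have e1 : (n : ℝ) ^ (1 - ρ) * ε ^ 2 = ρ * (n : ℝ) ^ ρ * E := by
    have : (n : ℝ) ^ (1 - ρ) = (n : ℝ) ^ ρ * (n : ℝ) ^ (1 - 2 * ρ) := by
      rw [← Real.rpow_add hn0]; congr 1; ring
    rw [this, hE]
    field_simp
  have e2 : (n : ℝ) * ε ^ 2 = (n : ℝ) ^ ρ * ((n : ℝ) ^ (1 - ρ) * ε ^ 2) := by
    have : (n : ℝ) = (n : ℝ) ^ ρ * (n : ℝ) ^ (1 - ρ) := by
      rw [← Real.rpow_add hn0]; simp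
    conv_lhs => rw [this]
    ring
  have e3 : E ≤ (n : ℝ) ^ (1 - ρ) * ε ^ 2 := by
    rw [e1]; exact le_mul_of_one_le_left (by linarith) hρn
  have e4 : (n : ℝ) ^ ρ ≤ n * ε ^ 2 := by
    rw [e2]; exact le_mul_of_one_le_right (by positivity) (by linarith)
  intro j k
  refine (hcore n p D h μp μm S hD (fun l => (hμ l).trans (le_abs_self M)) Ω P
    (fun i ω => (Y i ω, X i ω)) hlaw hind ε hε0 hε1 ((le_max_left _ _).trans hn) e4 j k).trans ?_
  refine le_trans ?_ hz2
  have e5 : Real.exp (-((n : ℝ) ^ (1 - ρ) * ε ^ 2)) ≤ Real.exp (-(πp / 4 * E)) :=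
    Real.exp_le_exp.2 (by nlinarith)
  linarith [Real.exp_pos (-(πp / 4 * E))]
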